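/- **Setting.** Let $\overline M$ be a smooth manifold with a semi-Riemannian metric $\overline g$ (of constant index) and an indefinite almost contact metric structure: a $(1,1)$-tensor field $\overline\phi$, a vector field $\xi$ and a $1$-form $\eta$, all smooth, with $$\overline\phi^2=-I+\eta\otimes\xi,\quad \eta(\xi)=1,\quad \eta\circ\overline\phi=0,\quad \overline\phi\,\xi=0,\quad \overline g(\overline\phi X,\overline\phi Y)=\overline g(X,Y)-\eta(X)\eta(Y),\quad \eta(X)=\overline g(\xi,X).$$ Let $\overline\nabla$ be the Levi-Civita connection of $\overline g$ and suppose that $\overline M$ is an *indefinite nearly $\mu$-Sasakian manifold*, where $\mu$ is a real-valued function on $\overline M$ (for example a constant): $$(\overline\nabla_X\overline\phi)Y+(\overline\nabla_Y\overline\phi)X=\mu\{2\overline g(X,Y)\xi-\eta(Y)X-\eta(X)Y\}.$$ Let $M$ be an (immersed) lightlike submanifold of $\overline M$: $\mathrm{Rad}\,TM=TM\cap TM^\perp$ is a smooth distribution of constant rank $r>0$. Fix smooth complements $S(TM)$ of $\mathrm{Rad}\,TM$ in $TM$ and $S(TM^\perp)$ of $\mathrm{Rad}\,TM$ in $TM^\perp$,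 and a smooth lightlike transversal bundle $l\mathrm{tr}(TM)$, that is, a totally null complement of $\mathrm{Rad}\,TM$ in $(S(TM)\perp S(TM^\perp))^\perp$. Put $\mathrm{tr}(TM)=l\mathrm{tr}(TM)\perp S(TM^\perp)$, so that $T\overline M|_M=TM\oplus \mathrm{tr}(TM)$. For $X,Y\in\Gamma(TM)$ and $V\in\Gamma(\mathrm{tr}(TM))$ decompose into components in $TM$ and in $\mathrm{tr}(TM)$: $$\overline\nabla_XY=\nabla_XY+h(X,Y),\qquad \overline\nabla_XV=-A_VX+\nabla^t_XV,\qquad \overline\phi X=\phi_1X+\varphi_1X,\qquad \overline\phi V=\phi_2V+\varphi_2V .$$ Suppose that $M$ is *QGCR-lightlike*: there are smooth distributions $D_1,D_2,D_0,\overline D$ on $M$ and smooth subbundles $\mathcal S\subseteq S(TM^\perp)$, $\mathcal L\subseteq l\mathrm{tr}(TM)$ such that $\mathrm{Rad}\,TM=D_1\oplus D_2$, $\overline\phi D_1=D_1$, $\overline\phi D_2\subseteq S(TM)$, $S(TM)=(\overline\phi D_2\oplus\overline D)\perp D_0$, $D_0$ is non-degenerate with $\overline\phi D_0\subseteq D_0$,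 and $\overline D=\overline\phi\mathcal S\oplus\overline\phi\mathcal L$. Suppose moreover that $M$ is *co-screen*, i.e. $\xi\in\Gamma(S(TM^\perp))$ along $M$. Put $D=\mathrm{Rad}\,TM\perp D_0\perp\overline\phi D_2$, so that $TM=D\oplus\overline D$. A distribution $W$ on $M$ is called integrable if $[X,Y]\in\Gamma(W)$ for all $X,Y\in\Gamma(W)$. **Theorem.** 1. $D$ is integrable if and only if, for all $X,Y\in\Gamma(D)$, $$h(X,\phi_1Y)+h(Y,\phi_1X)=2\varphi_1\nabla_YX+2\varphi_2h(X,Y)+2\mu\,\overline g(X,Y)\,\xi .$$ 2. $\overline D$ is integrable if and only if, for all $X,Y\in\Gamma(\overline D)$, $$A_{\varphi_1X}Y+A_{\varphi_1Y}X=-2\phi_1\nabla_YX-2\phi_2h(X,Y).$$ -/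

import Mathlib

open scoped Manifold ContDiff Topology

noncomputable section

/-! ### Semi-Riemannian metrics, connections, almost contact metric structures -/

section Ambient

variable {F : Type*} [NormedAddCommGroup F] [NormedSpace ℝ F]
  {N : Type*} [TopologicalSpace N] [ChartedSpace F N]

/-- A continuous bilinear form as an algebraic one. -/
def toAlgBilin {V : Type*} [AddCommGroup V] [Module ℝ V] [TopologicalSpace V]
    [IsTopologicalAddGroup V] [ContinuousSMul ℝ V] (B : V →L[ℝ] V →L[ℝ] ℝ) :
    LinearMap.BilinForm ℝ V :=
  LinearMap.mk₂ ℝ (fun v w ↦ B v w) (by simp) (by simp) (by simp) (by simp)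

/-- A semi-Riemannian metric on a manifold `N`: a smooth symmetric non-degenerate `(0,2)`-tensor
field of constant index. -/
structure SemiRiemannianMetric (F : Type*) [NormedAddCommGroup F] [NormedSpace ℝ F]
    (N : Type*) [TopologicalSpace N] [ChartedSpace F N] [IsManifold 𝓘(ℝ, F) ∞ N] where
  /-- the scalar product on each tangent space -/
  val (x : N) : TangentSpace 𝓘(ℝ, F) x →L[ℝ] TangentSpace 𝓘(ℝ, F) x →L[ℝ] ℝ
  symm (x : N) (v w : TangentSpace 𝓘(ℝ, F) x) : val x v w = val x w v
  nondegenerate (x : N) (v : TangentSpace 𝓘(ℝ, F) x) (hv : ∀ w, val x v w = 0) : v = 0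
  contMDiff : ContMDiff 𝓘(ℝ, F) (𝓘(ℝ, F).prod 𝓘(ℝ, F →L[ℝ] F →L[ℝ] ℝ)) ∞
    (fun x ↦ Bundle.TotalSpace.mk' (F →L[ℝ] F →L[ℝ] ℝ)
      (E := fun x : N ↦ TangentSpace 𝓘(ℝ, F) x →L[ℝ] TangentSpace 𝓘(ℝ, F) x →L[ℝ] ℝ) x (val x))
  /-- the index of the metric -/
  index : ℕ
  index_eq (x : N) :
    sigNeg (LinearMap.BilinMap.toQuadraticMap (toAlgBilin (val x))) = index

variable [IsManifold 𝓘(ℝ, F) ∞ N]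

/-- The orthogonal complement of a subspace of a tangent space. -/
def SemiRiemannianMetric.perp (g : SemiRiemannianMetric F N) (x : N)
    (W : Submodule ℝ (TangentSpace 𝓘(ℝ, F) x)) : Submodule ℝ (TangentSpace 𝓘(ℝ, F) x) :=
  (toAlgBilin (g.val x)).orthogonal W

/-- `cov` is the Levi-Civita connection of `g`: it is torsion-free, `∇_X Y - ∇_Y X = [X, Y]`, and
metric, `v (g(Y, Z)) = g(∇_v Y, Z) + g(Y, ∇_v Z)`. Here `cov Y x v` is `∇_v Y` at `x`. -/
structure IsLeviCivita (g : SemiRiemannianMetric F N)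
    (cov : CovariantDerivative 𝓘(ℝ, F) F (fun x : N ↦ TangentSpace 𝓘(ℝ, F) x)) : Prop where
  torsion_free : ∀ (X Y : ∀ x : N, TangentSpace 𝓘(ℝ, F) x) (x : N),
    MDiffAt (T% X) x → MDiffAt (T% Y) x →
      cov Y x (X x) - cov X x (Y x) = VectorField.mlieBracket 𝓘(ℝ, F) X Y x
  metric : ∀ (Y Z : ∀ x : N, TangentSpace 𝓘(ℝ, F) x) (x : N) (v : TangentSpace 𝓘(ℝ, F) x),
    MDiffAt (T% Y) x → MDiffAt (T% Z) x →
      mvfderiv 𝓘(ℝ, F) (fun y ↦ g.val y (Y y) (Z y)) x v =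
        g.val x (cov Y x v) (Z x) + g.val x (Y x) (cov Z x v)

/-- An indefinite almost contact metric structure `(φ, ξ, η, g)`. -/
structure AlmostContactMetricStructure (g : SemiRiemannianMetric F N) where
  φ (x : N) : TangentSpace 𝓘(ℝ, F) x →L[ℝ] TangentSpace 𝓘(ℝ, F) x
  ξ (x : N) : TangentSpace 𝓘(ℝ, F) x
  η (x : N) : TangentSpace 𝓘(ℝ, F) x →L[ℝ] ℝ
  φ_contMDiff : ContMDiff 𝓘(ℝ, F) (𝓘(ℝ, F).prod 𝓘(ℝ, F →L[ℝ] F)) ∞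
    (fun x ↦ Bundle.TotalSpace.mk' (F →L[ℝ] F)
      (E := fun x : N ↦ TangentSpace 𝓘(ℝ, F) x →L[ℝ] TangentSpace 𝓘(ℝ, F) x) x (φ x))
  ξ_contMDiff : ContMDiff 𝓘(ℝ, F) 𝓘(ℝ, F).tangent ∞ (T% ξ)
  η_contMDiff : ContMDiff 𝓘(ℝ, F) (𝓘(ℝ, F).prod 𝓘(ℝ, F →L[ℝ] ℝ)) ∞
    (fun x ↦ Bundle.TotalSpace.mk' (F →L[ℝ] ℝ)
      (E := fun x : N ↦ TangentSpace 𝓘(ℝ, F) x →L[ℝ] ℝ) x (η x))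
  φ_φ (x : N) (v : TangentSpace 𝓘(ℝ, F) x) : φ x (φ x v) = -v + η x v • ξ x
  η_ξ (x : N) : η x (ξ x) = 1
  η_φ (x : N) (v : TangentSpace 𝓘(ℝ, F) x) : η x (φ x v) = 0
  φ_ξ (x : N) : φ x (ξ x) = 0
  metric_φ (x : N) (v w : TangentSpace 𝓘(ℝ, F) x) :
    g.val x (φ x v) (φ x w) = g.val x v w - η x v * η x w
  η_eq (x : N) (v : TangentSpace 𝓘(ℝ, F) x) : η x v = g.val x (ξ x) v

/-- `(∇_X φ) Y = ∇_X (φ Y) - φ (∇_X Y)` at the point `x`. -/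
def covDerivEndo (cov : CovariantDerivative 𝓘(ℝ, F) F (fun x : N ↦ TangentSpace 𝓘(ℝ, F) x))
    (φ : ∀ x : N, TangentSpace 𝓘(ℝ, F) x →L[ℝ] TangentSpace 𝓘(ℝ, F) x)
    (X Y : ∀ x : N, TangentSpace 𝓘(ℝ, F) x) (x : N) : TangentSpace 𝓘(ℝ, F) x :=
  cov (fun y ↦ φ y (Y y)) x (X x) - φ x (cov Y x (X x))

/-- The nearly `μ`-Sasakian condition
`(∇_X φ) Y + (∇_Y φ) X = μ (2 g(X, Y) ξ - η(Y) X - η(X) Y)`, where `∇ = cov` is the Levi-Civita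
connection of `g`. Both sides are tensors, and the equation is imposed at `x` for all vector
fields that are differentiable at `x`. -/
structure IsNearlyMuSasakian {g : SemiRiemannianMetric F N} (C : AlmostContactMetricStructure g)
    (cov : CovariantDerivative 𝓘(ℝ, F) F (fun x : N ↦ TangentSpace 𝓘(ℝ, F) x))
    (μ : N → ℝ) : Prop where
  leviCivita : IsLeviCivita g cov
  nearly : ∀ (X Y : ∀ x : N, TangentSpace 𝓘(ℝ, F) x) (x : N),
    MDiffAt (T% X) x → MDiffAt (T% Y) x →
      covDerivEndo cov C.φ X Y x + covDerivEndo cov C.φ Y X x =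
        μ x • ((2 * g.val x (X x) (Y x)) • C.ξ x - C.η x (Y x) • X x - C.η x (X x) • Y x)

end Ambient

/-! ### Vector fields and subbundles along a map, lightlike submanifolds -/

section Submanifold

variable {E : Type*} [NormedAddCommGroup E] [NormedSpace ℝ E]
  {F : Type*} [NormedAddCommGroup F] [NormedSpace ℝ F]
  {M : Type*} [TopologicalSpace M] [ChartedSpace E M]
  {N : Type*} [TopologicalSpace N] [ChartedSpace F N]

/-- The tangent space of the submanifold `i : M → N` at `p`, as a subspace of `T_{i p} N`. -/
def tangentImage (E F : Type*) [NormedAddCommGroup E] [NormedSpace ℝ E]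
    [NormedAddCommGroup F] [NormedSpace ℝ F]
    {M : Type*} [TopologicalSpace M] [ChartedSpace E M]
    {N : Type*} [TopologicalSpace N] [ChartedSpace F N] (i : M → N) (p : M) :
    Submodule ℝ (TangentSpace 𝓘(ℝ, F) (i p)) :=
  LinearMap.range (mfderiv 𝓘(ℝ, E) 𝓘(ℝ, F) i p).toLinearMap

variable [IsManifold 𝓘(ℝ, F) ∞ N]

/-- The covariant derivative `∇_v V` at `p` of a vector field `V` along `i : M → N` (the pull-back
connection): in the trivialization of `TN` centred at `i p`, it is the sum of the derivative of
the components of `V` and of the covariant derivative, in the direction `di(v)`, of the field with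
constant components extending `V p`. For `V` the restriction of a field on `N` it is the covariant
derivative of that field, see `covAlong_comp`. -/
def covAlong (cov : CovariantDerivative 𝓘(ℝ, F) F (fun x : N ↦ TangentSpace 𝓘(ℝ, F) x))
    (i : M → N) (V : ∀ p : M, TangentSpace 𝓘(ℝ, F) (i p)) (p : M) (v : TangentSpace 𝓘(ℝ, E) p) :
    TangentSpace 𝓘(ℝ, F) (i p) :=
  (trivializationAt F (TangentSpace 𝓘(ℝ, F)) (i p)).symmL ℝ (i p)
      (mvfderiv 𝓘(ℝ, E)
        (fun q ↦ (trivializationAt F (TangentSpace 𝓘(ℝ, F)) (i p) ⟨i q, V q⟩).2) p v) +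
    cov (FiberBundle.extend F (V p)) (i p) (mfderiv 𝓘(ℝ, E) 𝓘(ℝ, F) i p v)

/-- Along the restriction to `i` of a field `V` on `N`, `covAlong` is `∇_{di(v)} V`. -/
theorem covAlong_comp [FiniteDimensional ℝ F]
    (cov : CovariantDerivative 𝓘(ℝ, F) F (fun x : N ↦ TangentSpace 𝓘(ℝ, F) x))
    (i : M → N) (V : ∀ x : N, TangentSpace 𝓘(ℝ, F) x) (p : M) (v : TangentSpace 𝓘(ℝ, E) p)
    (hi : MDifferentiableAt 𝓘(ℝ, E) 𝓘(ℝ, F) i p) (hV : MDiffAt (T% V) (i p)) :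
    covAlong cov i (fun q ↦ V (i q)) p v = cov V (i p) (mfderiv 𝓘(ℝ, E) 𝓘(ℝ, F) i p v) := by
  have : IsManifold 𝓘(ℝ, F) 1 N := IsManifold.of_le (n := ∞) (by simp)
  set x := i p with hx
  set e := trivializationAt F (TangentSpace 𝓘(ℝ, F)) x with he
  have hxe : x ∈ e.baseSet := FiberBundle.mem_baseSet_trivializationAt' x
  set w := mfderiv 𝓘(ℝ, E) 𝓘(ℝ, F) i p v with hw
  let f (σ : ∀ x : N, TangentSpace 𝓘(ℝ, F) x) : N → F := fun y ↦ (e ⟨y, σ y⟩).2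
  have hf (σ : ∀ x : N, TangentSpace 𝓘(ℝ, F) x) (hσ : MDiffAt (T% σ) x) :
      MDifferentiableAt 𝓘(ℝ, F) 𝓘(ℝ, F) (f σ) x := by
    rwa [mdifferentiableAt_section] at hσ
  have hnear : ∀ᶠ y in 𝓝 x, y ∈ e.baseSet := e.open_baseSet.mem_nhds hxe
  have hmv {a b : N → F} (h : a =ᶠ[𝓝 x] b) :
      mvfderiv 𝓘(ℝ, F) a x = mvfderiv 𝓘(ℝ, F) b x := by
    ext v
    exact congrArg (fun L : F →L[ℝ] F ↦ L v) h.mfderiv_eq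
  have hT : TensorialAt 𝓘(ℝ, F) F (V := fun x : N ↦ TangentSpace 𝓘(ℝ, F) x)
      (fun σ ↦ e.symmL ℝ x (mvfderiv 𝓘(ℝ, F) (f σ) x w) - cov σ x w) x := by
    constructor
    · intro h σ hh hσ
      have h1 : f (h • σ) =ᶠ[𝓝 x] h • f σ := by
        filter_upwards [hnear] with y hy
        exact (e.linear ℝ hy).map_smul (h y) (σ y)
      have h2 : e.symmL ℝ x (f σ x) = σ x := by
        rw [e.symmL_apply hxe]
        exact e.symm_apply_apply_mk hxe (σ x)
      have h3 : mvfderiv 𝓘(ℝ, F) (f (h • σ)) x = mvfderiv 𝓘(ℝ, F) (h • f σ) x := hmv h1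
      rw [h3, mvfderiv_smul hh (hf σ hσ), cov.isCovariantDerivativeOn.leibniz hσ hh]
      simp only [add_apply, smul_apply, ContinuousLinearMap.smulRight_apply, map_add, map_smul, h2]
      module
    · intro σ τ hσ hτ
      have h1 : f (σ + τ) =ᶠ[𝓝 x] f σ + f τ := by
        filter_upwards [hnear] with y hy
        exact (e.linear ℝ hy).map_add (σ y) (τ y)
      have h3 : mvfderiv 𝓘(ℝ, F) (f (σ + τ)) x = mvfderiv 𝓘(ℝ, F) (f σ + f τ) x := hmv h1
      rw [h3, mvfderiv_add (hf σ hσ) (hf τ hτ), cov.isCovariantDerivativeOn.add hσ hτ]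
      simp only [add_apply, map_add]
      module
  have h4 := hT.pointwise (FiberBundle.mdifferentiableAt_extend ..) hV
    (FiberBundle.extend_apply_self F (V x))
  have h5 : mvfderiv 𝓘(ℝ, F) (f (FiberBundle.extend F (V x))) x = 0 := by
    have : f (FiberBundle.extend F (V x)) =ᶠ[𝓝 x] fun _ ↦ (e ⟨x, V x⟩).2 := by
      filter_upwards [hnear] with y hy
      simp [f, FiberBundle.extend, ← he, hy]
    rw [hmv this, mvfderiv_const]
  have h6 : mvfderiv 𝓘(ℝ, E) (fun q ↦ (e ⟨i q, V (i q)⟩).2) p v =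
      mvfderiv 𝓘(ℝ, F) (f V) x w :=
    mfderiv_comp_apply p (hf V hV) hi v
  simp only [h5, zero_apply, map_zero] at h4
  simp only [covAlong, ← hx, ← he, ← hw, h6]
  rw [sub_eq_sub_iff_add_eq_add] at h4
  rw [← h4, zero_add]

variable [IsManifold 𝓘(ℝ, E) ∞ M]

variable (E) in
/-- `W` is a smooth vector subbundle of the pulled back tangent bundle `i^* TN`: around each point
it has a smooth local frame. -/
def IsSmoothSubbundle {i : M → N} (W : ∀ p : M, Submodule ℝ (TangentSpace 𝓘(ℝ, F) (i p))) : Prop :=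
  ∀ p : M, ∃ U ∈ 𝓝 p, ∃ (k : ℕ) (s : Fin k → ∀ q : M, TangentSpace 𝓘(ℝ, F) (i q)),
    (∀ j, ContMDiffOn 𝓘(ℝ, E) 𝓘(ℝ, F).tangent ∞
      (fun q ↦ (⟨i q, s j q⟩ : TangentBundle 𝓘(ℝ, F) N)) U) ∧
    ∀ q ∈ U, LinearIndependent ℝ (fun j ↦ s j q) ∧
      Submodule.span ℝ (Set.range fun j ↦ s j q) = W q

/-- A field along `i` given by the images of the values of a vector field on `M`. -/
def pushField (F : Type*) [NormedAddCommGroup F] [NormedSpace ℝ F] {N : Type*}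
    [TopologicalSpace N] [ChartedSpace F N] (i : M → N) (X : ∀ p : M, TangentSpace 𝓘(ℝ, E) p)
    (p : M) : TangentSpace 𝓘(ℝ, F) (i p) :=
  mfderiv 𝓘(ℝ, E) 𝓘(ℝ, F) i p (X p)

/-- `X ∈ Γ(W)`, for `W` a subbundle of the tangent bundle of the submanifold `i : M → N`: `X` is a
smooth vector field on `M` with values in `W`. -/
structure IsSectionOf {i : M → N} (W : ∀ p : M, Submodule ℝ (TangentSpace 𝓘(ℝ, F) (i p)))
    (X : ∀ p : M, TangentSpace 𝓘(ℝ, E) p) : Prop where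
  contMDiff : ContMDiff 𝓘(ℝ, E) 𝓘(ℝ, E).tangent ∞ (T% X)
  mem : ∀ p, pushField F i X p ∈ W p

variable (E) in
/-- A distribution `W` on the submanifold `i : M → N` is integrable: `[X, Y] ∈ Γ(W)` for all
`X, Y ∈ Γ(W)`. -/
def IsIntegrableDistribution {i : M → N}
    (W : ∀ p : M, Submodule ℝ (TangentSpace 𝓘(ℝ, F) (i p))) : Prop :=
  ∀ X Y : ∀ p : M, TangentSpace 𝓘(ℝ, E) p, IsSectionOf W X → IsSectionOf W Y →
    IsSectionOf W (VectorField.mlieBracket 𝓘(ℝ, E) X Y)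

end Submanifold

/-! ### Lightlike submanifolds -/

section Lightlike

/-- The differential of an immersion is injective. -/
theorem mfderiv_injective_of_isImmersion
    {E : Type*} [NormedAddCommGroup E] [NormedSpace ℝ E]
    {F : Type*} [NormedAddCommGroup F] [NormedSpace ℝ F]
    {M : Type*} [TopologicalSpace M] [ChartedSpace E M] [IsManifold 𝓘(ℝ, E) ∞ M]
    {N : Type*} [TopologicalSpace N] [ChartedSpace F N] [IsManifold 𝓘(ℝ, F) ∞ N]
    {i : M → N} (hi : Manifold.IsImmersion 𝓘(ℝ, E) 𝓘(ℝ, F) ∞ i) (p : M) :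
    Function.Injective (mfderiv 𝓘(ℝ, E) 𝓘(ℝ, F) i p).toLinearMap := by
  have h := hi.isImmersionAt p
  set φ := h.domChart.extend 𝓘(ℝ, E) with hφ
  set ψ := h.codChart.extend 𝓘(ℝ, F) with hψ
  have hdi : MDifferentiableAt 𝓘(ℝ, E) 𝓘(ℝ, F) i p :=
    h.contMDiffAt.mdifferentiableAt (by simp)
  have hsrc : φ.source = h.domChart.source := by simp [hφ]
  have hpsrc : p ∈ φ.source := hsrc ▸ h.mem_domChart_source
  have hnear : ∀ᶠ q in 𝓝 p, q ∈ φ.source := by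
    rw [hsrc]
    exact h.domChart.open_source.mem_nhds h.mem_domChart_source
  have hloc : ∀ q ∈ φ.source, ψ (i q) = h.equiv (φ q, 0) := by
    intro q hq
    have h1 := h.writtenInCharts (φ.map_source hq)
    have h2 : (ψ ∘ i ∘ φ.symm) (φ q) = ψ (i q) := by
      simp only [Function.comp_apply, φ.left_inv hq]
    rw [← h2]
    exact h1
  have hψd : MDifferentiableAt 𝓘(ℝ, F) 𝓘(ℝ, F) ψ (i p) :=
    (OpenPartialHomeomorph.contMDiffAt_extend h.codChart_mem_maximalAtlas
      h.mem_codChart_source).mdifferentiableAt (by simp)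
  have hφs : MDifferentiableAt 𝓘(ℝ, E) 𝓘(ℝ, E) φ.symm (φ p) := by
    have h1 := contMDiffOn_extend_symm h.domChart_mem_maximalAtlas
    have h2 : 𝓘(ℝ, E) '' h.domChart.target = h.domChart.target := by simp
    rw [h2] at h1
    exact (h1.contMDiffAt (h.domChart.open_target.mem_nhds
      (h.domChart.map_source h.mem_domChart_source))).mdifferentiableAt (by simp)
  let pr : F →L[ℝ] E :=
    (ContinuousLinearMap.fst ℝ E h.complement).comp h.equiv.symm.toContinuousLinearMap
  have hpr : ∀ q ∈ φ.source, pr (ψ (i q)) = φ q := by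
    intro q hq
    simp [pr, hloc q hq]
  have hG : MDifferentiableAt 𝓘(ℝ, F) 𝓘(ℝ, E) (φ.symm ∘ pr ∘ ψ) (i p) := by
    refine MDifferentiableAt.comp (I' := 𝓘(ℝ, E)) (i p) ?_
      (pr.differentiableAt.mdifferentiableAt.comp (i p) hψd)
    rw [Function.comp_apply, hpr p hpsrc]
    exact hφs
  have hid : (φ.symm ∘ pr ∘ ψ) ∘ i =ᶠ[𝓝 p] id := by
    filter_upwards [hnear] with q hq
    simp [hpr q hq, φ.left_inv hq]
  have hcomp := mfderiv_comp p hG hdi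
  have hpp : (φ.symm ∘ pr ∘ ψ) (i p) = p := hid.self_of_nhds
  have hide := hid.mfderiv_eq (I := 𝓘(ℝ, E)) (I' := 𝓘(ℝ, E))
  intro v w hvw
  have h1 (u : E) : (mfderiv 𝓘(ℝ, F) 𝓘(ℝ, E) (φ.symm ∘ pr ∘ ψ) (i p) : F → E)
      ((mfderiv 𝓘(ℝ, E) 𝓘(ℝ, F) i p : E → F) u) = u := by
    have h2 := congrArg (fun L : E →L[ℝ] E ↦ L u) (hcomp.symm.trans hide)
    have h3 := congrArg (fun L : E →L[ℝ] E ↦ L u) (mfderiv_id (I := 𝓘(ℝ, E)) (x := p))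
    exact h2.trans h3
  have h4 : (mfderiv 𝓘(ℝ, E) 𝓘(ℝ, F) i p : E → F) v =
      (mfderiv 𝓘(ℝ, E) 𝓘(ℝ, F) i p : E → F) w := hvw
  have h5 := h1 v
  rw [h4, h1 w] at h5
  exact h5.symm

/-- The linear algebra behind the decomposition `V = T ⊕ tr`: here `S` and `S'` are complements of
`T ⊓ Tᗮ` in `T` and in `Tᗮ`, and `L` is a totally isotropic complement of `T ⊓ Tᗮ` in the
orthogonal complement of `S ⊔ S'`. -/
theorem isCompl_transversal {V : Type*} [AddCommGroup V] [Module ℝ V] [FiniteDimensional ℝ V]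
    (B : LinearMap.BilinForm ℝ V) (hs : ∀ v w, B v w = B w v) (hn : ∀ v, (∀ w, B v w = 0) → v = 0)
    (T S S' L : Submodule ℝ V)
    (hS : Disjoint (T ⊓ B.orthogonal T) S) (hST : (T ⊓ B.orthogonal T) ⊔ S = T)
    (hS' : Disjoint (T ⊓ B.orthogonal T) S')
    (hST' : (T ⊓ B.orthogonal T) ⊔ S' = B.orthogonal T)
    (hL : ∀ v ∈ L, ∀ w ∈ L, B v w = 0)
    (hLR : (T ⊓ B.orthogonal T) ⊔ L = B.orthogonal S ⊓ B.orthogonal S') :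
    IsCompl T (L ⊔ S') := by
  have hrefl : B.IsRefl := fun v w h ↦ by rw [hs]; exact h
  have hnd : B.Nondegenerate := by
    refine ⟨fun v hv ↦ hn v hv, fun v hv ↦ hn v fun w ↦ ?_⟩
    rw [hs]; exact hv w
  have ho (W : Submodule ℝ V) (v : V) : v ∈ B.orthogonal W ↔ ∀ w ∈ W, B w v = 0 :=
    LinearMap.BilinForm.mem_orthogonal_iff
  set R := T ⊓ B.orthogonal T with hR
  have hoo (W : Submodule ℝ V) : B.orthogonal (B.orthogonal W) = W :=
    LinearMap.BilinForm.orthogonal_orthogonal hnd hrefl W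
  have hRT : R ≤ T := inf_le_left
  have hRT' : R ≤ B.orthogonal T := inf_le_right
  have hSleT : S ≤ T := hST ▸ le_sup_right
  have hS'le : S' ≤ B.orthogonal T := hST' ▸ le_sup_right
  -- `S ⊔ S'` is non-degenerate
  have key : ∀ v ∈ S ⊔ S', v ∈ B.orthogonal S → v ∈ B.orthogonal S' → v = 0 := by
    intro v hv hvS hvS'
    obtain ⟨a, ha, b, hb, rfl⟩ := Submodule.mem_sup.1 hv
    rw [ho] at hvS hvS'
    have ha0 : a = 0 := by
      have haT' : a ∈ B.orthogonal T := by
        rw [ho]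
        intro t ht
        rw [← hST] at ht
        obtain ⟨e, he, c, hc, rfl⟩ := Submodule.mem_sup.1 ht
        have h1 : B e a = 0 := by rw [hs]; exact (ho T e).1 (hRT' he) a (hSleT ha)
        have h2 : B c b = 0 := (ho T b).1 (hS'le hb) c (hSleT hc)
        have h3 := hvS c hc
        simp only [map_add, LinearMap.add_apply] at h3 ⊢
        linarith
      exact Submodule.disjoint_def.1 hS a ⟨hSleT ha, haT'⟩ ha
    have hb0 : b = 0 := by
      have hbT : b ∈ T := by
        rw [← hoo T, ho]
        intro t ht
        rw [← hST'] at ht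
        obtain ⟨e, he, c, hc, rfl⟩ := Submodule.mem_sup.1 ht
        have h1 : B e b = 0 := (ho T b).1 (hS'le hb) e (hRT he)
        have h2 : B c a = 0 := by rw [hs]; exact (ho T c).1 (hS'le hc) a (hSleT ha)
        have h3 := hvS' c hc
        simp only [map_add, LinearMap.add_apply] at h3 ⊢
        linarith
      exact Submodule.disjoint_def.1 hS' b ⟨hbT, hS'le hb⟩ hb
    rw [ha0, hb0, add_zero]
  have hLo : ∀ v ∈ R ⊔ L, v ∈ B.orthogonal S ∧ v ∈ B.orthogonal S' := by
    intro v hv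
    rw [hLR] at hv
    exact hv
  -- a vector of `R ⊔ L` orthogonal to `R ⊔ L` vanishes
  have key2 : ∀ v ∈ R ⊔ L, (∀ w ∈ R ⊔ L, B w v = 0) → v = 0 := by
    intro v hv hvo
    refine key v ?_ (hLo v hv).1 (hLo v hv).2
    rw [← hoo (S ⊔ S'), ho]
    intro w hw
    apply hvo
    rw [hLR]
    rw [ho] at hw
    exact ⟨(ho S w).2 fun c hc ↦ hw c (Submodule.mem_sup_left hc),
      (ho S' w).2 fun c hc ↦ hw c (Submodule.mem_sup_right hc)⟩
  have hRR : ∀ e ∈ R, ∀ e' ∈ R, B e e' = 0 := fun e he e' he' ↦ (ho T e').1 (hRT' he') e (hRT he)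
  constructor
  · rw [Submodule.disjoint_def]
    intro t ht htr
    obtain ⟨l, hl, s', hs', rfl⟩ := Submodule.mem_sup.1 htr
    have hl0 : l = 0 := by
      apply key2 l (Submodule.mem_sup_right hl)
      intro w hw
      obtain ⟨e, he, l', hl', rfl⟩ := Submodule.mem_sup.1 hw
      have h1 : B e (l + s') = 0 := by rw [hs]; exact (ho T e).1 (hRT' he) _ ht
      have h2 : B e s' = 0 := (ho T s').1 (hS'le hs') e (hRT he)
      have h3 := hL l' hl' l hl
      simp only [map_add, LinearMap.add_apply] at h1 ⊢
      linarith
    subst hl0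
    rw [zero_add] at ht ⊢
    exact Submodule.disjoint_def.1 hS' s' ⟨ht, hS'le hs'⟩ hs'
  · rw [codisjoint_iff]
    have hbot : B.orthogonal (T ⊔ (L ⊔ S')) = ⊥ := by
      rw [eq_bot_iff]
      intro v hv
      rw [ho] at hv
      have hvT : ∀ t ∈ T, B t v = 0 := fun t ht ↦ hv t (Submodule.mem_sup_left ht)
      have hvL : ∀ l ∈ L, B l v = 0 := fun l hl ↦
        hv l (Submodule.mem_sup_right (Submodule.mem_sup_left hl))
      have hvS' : ∀ c ∈ S', B c v = 0 := fun l hl ↦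
        hv l (Submodule.mem_sup_right (Submodule.mem_sup_right hl))
      apply key2 v
      · rw [hLR]
        exact ⟨(ho S v).2 fun c hc ↦ hvT c (hSleT hc), (ho S' v).2 hvS'⟩
      · intro w hw
        obtain ⟨e, he, l', hl', rfl⟩ := Submodule.mem_sup.1 hw
        rw [map_add, LinearMap.add_apply, hvT e (hRT he), hvL l' hl', add_zero]
    rw [← hoo (T ⊔ (L ⊔ S')), hbot]
    rw [eq_top_iff]
    intro v _
    rw [ho]
    intro w hw
    rw [(Submodule.mem_bot ℝ).1 hw]
    simp

variable {E : Type*} [NormedAddCommGroup E] [NormedSpace ℝ E]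
  {F : Type*} [NormedAddCommGroup F] [NormedSpace ℝ F]
  {M : Type*} [TopologicalSpace M] [ChartedSpace E M] [IsManifold 𝓘(ℝ, E) ∞ M]
  {N : Type*} [TopologicalSpace N] [ChartedSpace F N] [IsManifold 𝓘(ℝ, F) ∞ N]

/-- The radical `Rad T_p M = T_p M ∩ T_p M^⊥` of the submanifold `i : M → N` at `p`. -/
def radicalSpace (E : Type*) [NormedAddCommGroup E] [NormedSpace ℝ E]
    {M : Type*} [TopologicalSpace M] [ChartedSpace E M]
    (g : SemiRiemannianMetric F N) (i : M → N) (p : M) :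
    Submodule ℝ (TangentSpace 𝓘(ℝ, F) (i p)) :=
  tangentImage E F i p ⊓ g.perp (i p) (tangentImage E F i p)

/-- A lightlike submanifold `(M, g, S(TM), S(TM^⊥))` of a semi-Riemannian manifold, with a lightlike
transversal bundle `ltr(TM)`. The tangent bundle of `M` and all other bundles are regarded as
subbundles of the pulled back tangent bundle of the ambient manifold. -/
structure LightlikeSubmanifold (g : SemiRiemannianMetric F N) (i : M → N) where
  immersion : Manifold.IsImmersion 𝓘(ℝ, E) 𝓘(ℝ, F) ∞ i
  /-- the rank of the radical distribution -/
  r : ℕ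
  r_pos : 0 < r
  rad_smooth : IsSmoothSubbundle E (radicalSpace E g i)
  rad_finrank (p : M) : Module.finrank ℝ (radicalSpace E g i p) = r
  /-- the screen distribution `S(TM)` -/
  screen (p : M) : Submodule ℝ (TangentSpace 𝓘(ℝ, F) (i p))
  screen_smooth : IsSmoothSubbundle E screen
  /-- `TM = Rad TM ⊥ S(TM)`; in particular `S(TM)` is non-degenerate -/
  screen_disjoint (p : M) : Disjoint (radicalSpace E g i p) (screen p)
  screen_sup (p : M) : radicalSpace E g i p ⊔ screen p = tangentImage E F i p
  /-- the screen transversal bundle `S(TM^⊥)` -/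
  screenTrans (p : M) : Submodule ℝ (TangentSpace 𝓘(ℝ, F) (i p))
  screenTrans_smooth : IsSmoothSubbundle E screenTrans
  /-- `TM^⊥ = Rad TM ⊥ S(TM^⊥)`; in particular `S(TM^⊥)` is non-degenerate -/
  screenTrans_disjoint (p : M) : Disjoint (radicalSpace E g i p) (screenTrans p)
  screenTrans_sup (p : M) :
    radicalSpace E g i p ⊔ screenTrans p = g.perp (i p) (tangentImage E F i p)
  /-- the lightlike transversal bundle `ltr(TM)`: a totally null complement of `Rad TM` in the
  orthogonal complement of `S(TM) ⊥ S(TM^⊥)`. Equivalently, any basis `E_j` of the radical has a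
  dual basis `N_j` of `ltr(TM)`, with `g(E_j, N_k) = δ_jk` and `g(N_j, N_k) = 0`. -/
  ltr (p : M) : Submodule ℝ (TangentSpace 𝓘(ℝ, F) (i p))
  ltr_smooth : IsSmoothSubbundle E ltr
  ltr_null (p : M) (v w : TangentSpace 𝓘(ℝ, F) (i p)) (hv : v ∈ ltr p) (hw : w ∈ ltr p) :
    g.val (i p) v w = 0
  ltr_disjoint (p : M) : Disjoint (radicalSpace E g i p) (ltr p)
  ltr_sup (p : M) :
    radicalSpace E g i p ⊔ ltr p = g.perp (i p) (screen p) ⊓ g.perp (i p) (screenTrans p)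

namespace LightlikeSubmanifold

variable {g : SemiRiemannianMetric F N} {i : M → N} (L : LightlikeSubmanifold (E := E) g i)

/-- The transversal bundle `tr(TM) = ltr(TM) ⊥ S(TM^⊥)`. -/
def tr (p : M) : Submodule ℝ (TangentSpace 𝓘(ℝ, F) (i p)) := L.ltr p ⊔ L.screenTrans p

theorem isCompl_tr [FiniteDimensional ℝ F] (p : M) : IsCompl (tangentImage E F i p) (L.tr p) :=
  have : FiniteDimensional ℝ (TangentSpace 𝓘(ℝ, F) (i p)) := inferInstanceAs
    (FiniteDimensional ℝ F)
  isCompl_transversal (toAlgBilin (g.val (i p))) (g.symm (i p)) (g.nondegenerate (i p))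
    (tangentImage E F i p) (L.screen p) (L.screenTrans p) (L.ltr p)
    (L.screen_disjoint p) (L.screen_sup p) (L.screenTrans_disjoint p) (L.screenTrans_sup p)
    (fun v hv w hw ↦ L.ltr_null p v w hv hw) (L.ltr_sup p)

variable [FiniteDimensional ℝ F]

/-- The tangential part, in `T_p M`, of a vector of `T_{i p} N = T_p M ⊕ tr(TM)_p`. -/
def tan (p : M) : TangentSpace 𝓘(ℝ, F) (i p) →ₗ[ℝ] TangentSpace 𝓘(ℝ, E) p :=
  (LinearEquiv.ofInjective (mfderiv 𝓘(ℝ, E) 𝓘(ℝ, F) i p).toLinearMap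
    (mfderiv_injective_of_isImmersion L.immersion p)).symm.toLinearMap ∘ₗ
  Submodule.projectionOnto (tangentImage E F i p) (L.tr p) (L.isCompl_tr p)

/-- The transversal part, in `tr(TM)_p`, of a vector of `T_{i p} N = T_p M ⊕ tr(TM)_p`. -/
def trans (p : M) : TangentSpace 𝓘(ℝ, F) (i p) →ₗ[ℝ] TangentSpace 𝓘(ℝ, F) (i p) :=
  Submodule.projection (L.tr p) (tangentImage E F i p) (L.isCompl_tr p).symm

/-- Every ambient vector is the sum of its tangential and transversal parts. -/
theorem tan_add_trans (p : M) (w : TangentSpace 𝓘(ℝ, F) (i p)) :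
    mfderiv 𝓘(ℝ, E) 𝓘(ℝ, F) i p (L.tan p w) + L.trans p w = w := by
  have h1 : mfderiv 𝓘(ℝ, E) 𝓘(ℝ, F) i p (L.tan p w) =
      (Submodule.projectionOnto (tangentImage E F i p) (L.tr p) (L.isCompl_tr p) w :
        TangentSpace 𝓘(ℝ, F) (i p)) :=
    congrArg Subtype.val ((LinearEquiv.ofInjective (mfderiv 𝓘(ℝ, E) 𝓘(ℝ, F) i p).toLinearMap
      (mfderiv_injective_of_isImmersion L.immersion p)).apply_symm_apply
        (Submodule.projectionOnto (tangentImage E F i p) (L.tr p) (L.isCompl_tr p) w))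
  rw [h1, trans, Submodule.coe_projectionOnto_apply]
  exact Submodule.projection_add_projection_eq_self (L.isCompl_tr p) w

variable (cov : CovariantDerivative 𝓘(ℝ, F) F (fun x : N ↦ TangentSpace 𝓘(ℝ, F) x))

/-- The induced connection `∇_X Y` on `TM`: the tangential part of the ambient derivative. -/
def conn (X Y : ∀ p : M, TangentSpace 𝓘(ℝ, E) p) (p : M) : TangentSpace 𝓘(ℝ, E) p :=
  L.tan p (covAlong cov i (pushField F i Y) p (X p))

/-- The second fundamental form `h(X, Y)`: the transversal part of the ambient derivative. -/
def secondFF (X Y : ∀ p : M, TangentSpace 𝓘(ℝ, E) p) (p : M) : TangentSpace 𝓘(ℝ, F) (i p) :=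
  L.trans p (covAlong cov i (pushField F i Y) p (X p))

/-- The shape operator `A_V X` of a section `V` of `tr(TM)`: minus the tangential part of the
ambient derivative of `V` in the direction `X`. -/
def shape (V : ∀ p : M, TangentSpace 𝓘(ℝ, F) (i p)) (X : ∀ p : M, TangentSpace 𝓘(ℝ, E) p)
    (p : M) : TangentSpace 𝓘(ℝ, E) p :=
  -L.tan p (covAlong cov i V p (X p))

variable (C : AlmostContactMetricStructure g)

/-- `φ₁ X`, the tangential part of `φ X` for `X` tangent to `M`. -/
def phi₁ (X : ∀ p : M, TangentSpace 𝓘(ℝ, E) p) (p : M) : TangentSpace 𝓘(ℝ, E) p :=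
  L.tan p (C.φ (i p) (pushField F i X p))

/-- `ϕ₁ X`, the transversal part of `φ X` for `X` tangent to `M`. -/
def varphi₁ (X : ∀ p : M, TangentSpace 𝓘(ℝ, E) p) (p : M) : TangentSpace 𝓘(ℝ, F) (i p) :=
  L.trans p (C.φ (i p) (pushField F i X p))

/-- `φ₂ V`, the tangential part of `φ V` for a section `V` of `tr(TM)`. -/
def phi₂ (V : ∀ p : M, TangentSpace 𝓘(ℝ, F) (i p)) (p : M) : TangentSpace 𝓘(ℝ, E) p :=
  L.tan p (C.φ (i p) (V p))

/-- `ϕ₂ V`, the transversal part of `φ V` for a section `V` of `tr(TM)`. -/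
def varphi₂ (V : ∀ p : M, TangentSpace 𝓘(ℝ, F) (i p)) (p : M) : TangentSpace 𝓘(ℝ, F) (i p) :=
  L.trans p (C.φ (i p) (V p))

end LightlikeSubmanifold

/-- The image `φ W` of a subbundle of the pulled back tangent bundle. -/
def AlmostContactMetricStructure.image {g : SemiRiemannianMetric F N}
    (C : AlmostContactMetricStructure g) {i : M → N}
    (W : ∀ p : M, Submodule ℝ (TangentSpace 𝓘(ℝ, F) (i p))) (p : M) :
    Submodule ℝ (TangentSpace 𝓘(ℝ, F) (i p)) :=
  (W p).map (C.φ (i p)).toLinearMap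

/-- A quasi generalized CR (QGCR) structure on a lightlike submanifold:
`Rad TM = D₁ ⊕ D₂`, `φ D₁ = D₁`, `φ D₂ ⊆ S(TM)`, `S(TM) = (φ D₂ ⊕ D̄) ⊥ D₀`, `φ D₀ ⊆ D₀`,
`D̄ = φ 𝒮 ⊕ φ ℒ`, with `D₀` non-degenerate, `ℒ ⊆ ltr(TM)` and `𝒮 ⊆ S(TM^⊥)`. -/
structure QGCRStructure {g : SemiRiemannianMetric F N} {i : M → N}
    (L : LightlikeSubmanifold (E := E) g i) (C : AlmostContactMetricStructure g) where
  D₁ (p : M) : Submodule ℝ (TangentSpace 𝓘(ℝ, F) (i p))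
  D₂ (p : M) : Submodule ℝ (TangentSpace 𝓘(ℝ, F) (i p))
  D₀ (p : M) : Submodule ℝ (TangentSpace 𝓘(ℝ, F) (i p))
  Dbar (p : M) : Submodule ℝ (TangentSpace 𝓘(ℝ, F) (i p))
  subS (p : M) : Submodule ℝ (TangentSpace 𝓘(ℝ, F) (i p))
  subL (p : M) : Submodule ℝ (TangentSpace 𝓘(ℝ, F) (i p))
  D₁_smooth : IsSmoothSubbundle E D₁
  D₂_smooth : IsSmoothSubbundle E D₂
  D₀_smooth : IsSmoothSubbundle E D₀
  Dbar_smooth : IsSmoothSubbundle E Dbar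
  subS_smooth : IsSmoothSubbundle E subS
  subL_smooth : IsSmoothSubbundle E subL
  rad_disjoint (p : M) : Disjoint (D₁ p) (D₂ p)
  rad_sup (p : M) : D₁ p ⊔ D₂ p = radicalSpace E g i p
  φ_D₁ (p : M) : C.image D₁ p = D₁ p
  φ_D₂ (p : M) : C.image D₂ p ≤ L.screen p
  D₂_Dbar_disjoint (p : M) : Disjoint (C.image D₂ p) (Dbar p)
  D₀_disjoint (p : M) : Disjoint (C.image D₂ p ⊔ Dbar p) (D₀ p)
  D₀_orthogonal (p : M) : D₀ p ≤ g.perp (i p) (C.image D₂ p ⊔ Dbar p)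
  screen_sup (p : M) : C.image D₂ p ⊔ Dbar p ⊔ D₀ p = L.screen p
  D₀_nondegenerate (p : M) : Disjoint (D₀ p) (g.perp (i p) (D₀ p))
  φ_D₀ (p : M) : C.image D₀ p ≤ D₀ p
  subS_le (p : M) : subS p ≤ L.screenTrans p
  subL_le (p : M) : subL p ≤ L.ltr p
  Dbar_disjoint (p : M) : Disjoint (C.image subS p) (C.image subL p)
  Dbar_sup (p : M) : C.image subS p ⊔ C.image subL p = Dbar p

/-- The distribution `D = Rad TM ⊥ D₀ ⊥ φ D₂`, for which `TM = D ⊕ D̄`. -/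
def QGCRStructure.D {g : SemiRiemannianMetric F N} {i : M → N}
    {L : LightlikeSubmanifold (E := E) g i} {C : AlmostContactMetricStructure g}
    (Q : QGCRStructure L C) (p : M) : Submodule ℝ (TangentSpace 𝓘(ℝ, F) (i p)) :=
  radicalSpace E g i p ⊔ Q.D₀ p ⊔ C.image Q.D₂ p

/-- The submanifold is co-screen: `ξ ∈ Γ(S(TM^⊥))`. -/
def LightlikeSubmanifold.IsCoScreen {g : SemiRiemannianMetric F N} {i : M → N}
    (L : LightlikeSubmanifold (E := E) g i) (C : AlmostContactMetricStructure g) : Prop :=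
  ∀ p, C.ξ (i p) ∈ L.screenTrans p

end Lightlike

end

/-! Since `ξ` lies in `S(TM^⊥)`, `η` vanishes on tangent vectors, so `φ² = -1` there and `φ` is
injective on `TM`. The QGCR conditions make `φ` map `D` into `D`. They also make it map `D̄` into
`tr(TM)`, because `φ² = -1 + η ⊗ ξ` and `ξ` is itself transversal. Hence a tangent vector `v` lies
in `D` exactly when `φ v` has no transversal part, and in `D̄` exactly when `φ v` has no tangential
part (`trans_φ_eq_zero_iff`, `tan_φ_eq_zero_iff`).

Write `∇̄` for the ambient connection. The nearly `μ`-Sasakian identity, in which the `η` terms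
vanish, expresses `∇̄_X(φY) + ∇̄_Y(φX)` through `φ∇̄_X Y + φ∇̄_Y X`. Replacing `∇̄_X Y` by `[X, Y] +
∇̄_Y X` turns this into `φ[X, Y] + 2φ(∇_Y X + h(X, Y))` plus a multiple of `ξ`
(`covAlong_add_covAlong_of_isCoScreen`). The transversal part on `D`, or the tangential part on
`D̄`, says that the stated formula fails exactly by that part of `φ[X, Y]`, so it holds if and only
if `[X, Y]` lies in the distribution.

The analytic work is to use ambient identities for fields defined only along the immersion. Such
fields extend locally, and brackets of related fields are related. -/

set_option linter.unusedSectionVars false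

/-! ### The Lie bracket as a commutator of derivations -/

section LieBracket

variable {E : Type*} [NormedAddCommGroup E] [NormedSpace ℝ E]
  {F : Type*} [NormedAddCommGroup F] [NormedSpace ℝ F]
  {M : Type*} [TopologicalSpace M] [ChartedSpace E M] [IsManifold 𝓘(ℝ, E) ∞ M]

/-- The derivative of a function along a vector field, read in a chart. -/
theorem fderiv_comp_extChartAt_symm_apply {f : M → F} (X : ∀ q : M, TangentSpace 𝓘(ℝ, E) q) {p : M}
    {y : E} (hy : y ∈ (extChartAt 𝓘(ℝ, E) p).target)
    (hf : MDifferentiableAt 𝓘(ℝ, E) 𝓘(ℝ, F) f ((extChartAt 𝓘(ℝ, E) p).symm y)) :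
    fderiv ℝ (f ∘ (extChartAt 𝓘(ℝ, E) p).symm) y
        (VectorField.mpullbackWithin 𝓘(ℝ, E) 𝓘(ℝ, E) (extChartAt 𝓘(ℝ, E) p).symm X
          (Set.range 𝓘(ℝ, E)) y) =
      mvfderiv 𝓘(ℝ, E) f ((extChartAt 𝓘(ℝ, E) p).symm y)
        (X ((extChartAt 𝓘(ℝ, E) p).symm y)) := by
  have : IsManifold 𝓘(ℝ, E) 1 M := IsManifold.of_le (n := ∞) (by simp)
  have hs := mdifferentiableWithinAt_extChartAt_symm (I := 𝓘(ℝ, E)) hy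
  have hinv := isInvertible_mfderivWithin_extChartAt_symm (I := 𝓘(ℝ, E)) hy
  have hr : Set.range 𝓘(ℝ, E) = Set.univ := by simp
  rw [VectorField.mpullbackWithin_apply]
  simp only [hr, mfderivWithin_univ, mdifferentiableWithinAt_univ] at hs hinv ⊢
  have h1 := mfderiv_comp y hf hs
  rw [mfderiv_eq_fderiv] at h1
  -- The pulled-back field is the inverse of the derivative of `φ.symm` applied to `X`, so the chain
  -- rule leaves a derivative composed with its inverse.
  have h2 := hinv.self_apply_inverse (X ((extChartAt 𝓘(ℝ, E) p).symm y))
  set w := (mfderiv 𝓘(ℝ, E) 𝓘(ℝ, E) (extChartAt 𝓘(ℝ, E) p).symm y).inverse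
    (X ((extChartAt 𝓘(ℝ, E) p).symm y))
  have h3 := congrArg (fun L : E →L[ℝ] F ↦ L w) h1
  refine h3.trans ?_
  exact congrArg (mfderiv 𝓘(ℝ, E) 𝓘(ℝ, F) f ((extChartAt 𝓘(ℝ, E) p).symm y)) h2

/-- The differentiation operator along `[X, Y]` is the commutator of the differentiation operators
along `X` and `Y`. -/
theorem mvfderiv_apply_mlieBracket [CompleteSpace E] {f : M → F} {X Y : ∀ q : M, TangentSpace 𝓘(ℝ, E) q} {p : M}
    (hf : ContMDiffAt 𝓘(ℝ, E) 𝓘(ℝ, F) ∞ f p) (hX : MDiffAt (T% X) p) (hY : MDiffAt (T% Y) p) :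
    mvfderiv 𝓘(ℝ, E) f p (VectorField.mlieBracket 𝓘(ℝ, E) X Y p) =
      mvfderiv 𝓘(ℝ, E) (fun q ↦ mvfderiv 𝓘(ℝ, E) f q (Y q)) p (X p) -
        mvfderiv 𝓘(ℝ, E) (fun q ↦ mvfderiv 𝓘(ℝ, E) f q (X q)) p (Y p) := by
  have : IsManifold 𝓘(ℝ, E) 1 M := IsManifold.of_le (n := ∞) (by simp)
  have : IsManifold 𝓘(ℝ, E) 2 M := IsManifold.of_le (n := ∞) ENat.LEInfty.out
  set φ := extChartAt 𝓘(ℝ, E) p with hφ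
  have hr : Set.range 𝓘(ℝ, E) = Set.univ := by simp
  have hφd : MDifferentiableAt 𝓘(ℝ, E) 𝓘(ℝ, E) φ p :=
    mdifferentiableAt_extChartAt (mem_chart_source E p)
  -- The tangent space at `p` is identified with `E` through this very chart, so at `p` itself no
  -- change of coordinates appears.
  have hφ' : mfderiv 𝓘(ℝ, E) 𝓘(ℝ, E) φ p = ContinuousLinearMap.id ℝ E := mfderiv_extChartAt_self
  have hφp : φ.symm (φ p) = p := extChartAt_to_inv p
  have htarget : ∀ᶠ y in 𝓝 (φ p), y ∈ φ.target := extChartAt_target_mem_nhds p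
  have hcont : Filter.Tendsto φ.symm (𝓝 (φ p)) (𝓝 p) := by
    have := continuousAt_extChartAt_symm (I := 𝓘(ℝ, E)) p
    rwa [ContinuousAt, ← hφ, hφp] at this
  have hfnear : ∀ᶠ q in 𝓝 p, MDifferentiableAt 𝓘(ℝ, E) 𝓘(ℝ, F) f q := by
    filter_upwards [(contMDiffAt_iff_contMDiffAt_nhds (n := 1) (by simp)).1
      (hf.of_le (by simp))] with q hq
    exact hq.mdifferentiableAt (by simp)
  have hhat : ContDiffAt ℝ ∞ (f ∘ φ.symm) (φ p) := by
    have h1 := (contMDiffAt_iff.1 hf).2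
    rwa [hr, contDiffWithinAt_univ] at h1
  have hs : φ.symm ⁻¹' Set.univ ∩ Set.range 𝓘(ℝ, E) = Set.univ := by simp
  let Z' (Z : ∀ q : M, TangentSpace 𝓘(ℝ, E) q) : E → E :=
    VectorField.mpullbackWithin 𝓘(ℝ, E) 𝓘(ℝ, E) φ.symm Z (Set.range 𝓘(ℝ, E))
  have hZd {Z : ∀ q : M, TangentSpace 𝓘(ℝ, E) q} (hZ : MDiffAt (T% Z) p) :
      DifferentiableAt ℝ (Z' Z) (φ p) := by
    have h1 : DifferentiableWithinAt ℝ (Z' Z) (φ.symm ⁻¹' Set.univ ∩ Set.range 𝓘(ℝ, E)) (φ p) :=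
      (hZ.mdifferentiableWithinAt
        (s := Set.univ)).differentiableWithinAt_mpullbackWithin_vectorField
    rwa [hs, differentiableWithinAt_univ] at h1
  have hZp (Z : ∀ q : M, TangentSpace 𝓘(ℝ, E) q) : Z' Z (φ p) = Z p := by
    have h1 := mfderivWithin_extChartAt_symm_inverse_apply (I := 𝓘(ℝ, E)) (x := p)
      (Z (φ.symm (φ p)))
    refine h1.trans ?_
    rw [hφp]
  have hchart {a : M → F} (ha : DifferentiableAt ℝ (a ∘ φ.symm) (φ p)) :
      mvfderiv 𝓘(ℝ, E) a p = fderiv ℝ (a ∘ φ.symm) (φ p) := by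
    have h1 : (a ∘ φ.symm) ∘ φ =ᶠ[𝓝 p] a := by
      filter_upwards [extChartAt_source_mem_nhds (I := 𝓘(ℝ, E)) p] with q hq
      exact congrArg a (φ.left_inv hq)
    have h2 := mfderiv_comp p ha.mdifferentiableAt hφd
    rw [mfderiv_eq_fderiv, hφ'] at h2
    exact (h1.mfderiv_eq (I := 𝓘(ℝ, E)) (I' := 𝓘(ℝ, F))).symm.trans h2
  have hdir {Z : ∀ q : M, TangentSpace 𝓘(ℝ, E) q} (hZ : MDiffAt (T% Z) p) :
      mvfderiv 𝓘(ℝ, E) (fun q ↦ mvfderiv 𝓘(ℝ, E) f q (Z q)) p =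
        fderiv ℝ (fun y ↦ fderiv ℝ (f ∘ φ.symm) y (Z' Z y)) (φ p) := by
    have h1 : (fun q ↦ mvfderiv 𝓘(ℝ, E) f q (Z q)) ∘ φ.symm =ᶠ[𝓝 (φ p)]
        fun y ↦ fderiv ℝ (f ∘ φ.symm) y (Z' Z y) := by
      filter_upwards [htarget, hcont.eventually hfnear] with y hy hfy
      exact (fderiv_comp_extChartAt_symm_apply Z hy hfy).symm
    -- The coordinate field is only differentiable at the point; the smoothness of `f` supplies the
    -- derivative of `fderiv`.
    have h2 : DifferentiableAt ℝ (fun y ↦ fderiv ℝ (f ∘ φ.symm) y (Z' Z y)) (φ p) :=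
      ((hhat.fderiv_right (m := 1) (by rw [one_add_one_eq_two]; exact ENat.LEInfty.out)).differentiableAt (by simp)).clm_apply (hZd hZ)
    rw [hchart (h1.differentiableAt_iff.2 h2), h1.fderiv_eq]
  have hbr : VectorField.mlieBracket 𝓘(ℝ, E) X Y p =
      VectorField.lieBracket ℝ (Z' X) (Z' Y) (φ p) := by
    let T : E →L[ℝ] E := mfderiv 𝓘(ℝ, E) 𝓘(ℝ, E) φ p
    -- By definition the bracket on `M` is the pullback of the coordinate bracket by the chart, and
    -- the derivative of the chart at `p` is the identity.
    change T.inverse (VectorField.lieBracketWithin ℝ (Z' X) (Z' Y)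
        (φ.symm ⁻¹' Set.univ ∩ Set.range 𝓘(ℝ, E)) (φ p)) = _
    have h1 : T.inverse = ContinuousLinearMap.id ℝ E := by
      rw [show T = ContinuousLinearMap.id ℝ E from hφ', ContinuousLinearMap.inverse_id]
    rw [h1, hs, VectorField.lieBracketWithin_univ]
    rfl
  -- The vector space case, where the second derivatives of `f` cancel by symmetry.
  have hE := VectorField.fderiv_apply_lieBracket hhat (by simpa using ENat.LEInfty.out)
    (hZd hY) (hZd hX)
  rw [hdir hX, hdir hY, hbr, hchart (hhat.differentiableAt (by simp)), ← hZp X, ← hZp Y]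
  exact hE

end LieBracket

/-! ### Related vector fields and extension from an immersed submanifold -/

section Related

variable {E : Type*} [NormedAddCommGroup E] [NormedSpace ℝ E]
  {F : Type*} [NormedAddCommGroup F] [NormedSpace ℝ F]
  {M : Type*} [TopologicalSpace M] [ChartedSpace E M] [IsManifold 𝓘(ℝ, E) ∞ M]
  {N : Type*} [TopologicalSpace N] [ChartedSpace F N] [IsManifold 𝓘(ℝ, F) ∞ N]

/-- The bracket of `i`-related vector fields is `i`-related. -/
theorem mlieBracket_apply_of_related [CompleteSpace E] [CompleteSpace F] {i : M → N}
    {X Y : ∀ q : M, TangentSpace 𝓘(ℝ, E) q}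
    {X' Y' : ∀ y : N, TangentSpace 𝓘(ℝ, F) y} {p : M} (hi : ContMDiff 𝓘(ℝ, E) 𝓘(ℝ, F) ∞ i)
    (hX : MDiffAt (T% X) p) (hY : MDiffAt (T% Y) p)
    (hX' : MDiffAt (T% X') (i p)) (hY' : MDiffAt (T% Y') (i p))
    (hXX' : ∀ᶠ q in 𝓝 p, X' (i q) = pushField F i X q)
    (hYY' : ∀ᶠ q in 𝓝 p, Y' (i q) = pushField F i Y q) :
    VectorField.mlieBracket 𝓘(ℝ, F) X' Y' (i p) =
      pushField F i (VectorField.mlieBracket 𝓘(ℝ, E) X Y) p := by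
  have : IsManifold 𝓘(ℝ, F) 1 N := IsManifold.of_le (n := ∞) (by simp)
  -- A chart centred at `i p` serves as a vector-valued test function: its derivative at `i p` is
  -- the identity, so differentiating it along a vector recovers the vector.
  set f := extChartAt 𝓘(ℝ, F) (i p)
  have hf : ContMDiffAt 𝓘(ℝ, F) 𝓘(ℝ, F) ∞ f (i p) := contMDiffAt_extChartAt
  have hfi : ContMDiffAt 𝓘(ℝ, E) 𝓘(ℝ, F) ∞ (f ∘ i) p := hf.comp p hi.contMDiffAt
  have hid : MDifferentiable 𝓘(ℝ, E) 𝓘(ℝ, F) i := hi.mdifferentiable (by simp)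
  have hsrc : ∀ᶠ y in 𝓝 (i p), y ∈ (chartAt F (i p)).source := chart_source_mem_nhds F (i p)
  have hchain {a : N → F} {q : M} (ha : MDifferentiableAt 𝓘(ℝ, F) 𝓘(ℝ, F) a (i q))
      (v : TangentSpace 𝓘(ℝ, E) q) : mvfderiv 𝓘(ℝ, E) (a ∘ i) q v =
        mvfderiv 𝓘(ℝ, F) a (i q) (mfderiv 𝓘(ℝ, E) 𝓘(ℝ, F) i q v) :=
    mfderiv_comp_apply q ha (hid q) v
  have hd {Z' : ∀ y : N, TangentSpace 𝓘(ℝ, F) y} (hZ' : MDiffAt (T% Z') (i p)) :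
      MDifferentiableAt 𝓘(ℝ, F) 𝓘(ℝ, F) (fun y ↦ mvfderiv 𝓘(ℝ, F) f y (Z' y)) (i p) := by
    rw [mdifferentiableAt_section] at hZ'
    -- On the chart domain the derivative of the chart is the trivialization of the tangent bundle,
    -- so the function in question is the coordinate expression of `Z'`.
    refine hZ'.congr_of_eventuallyEq ?_
    filter_upwards [hsrc] with y hy
    have h1 := TangentBundle.continuousLinearMapAt_trivializationAt (I := 𝓘(ℝ, F)) hy
    have h2 := congrArg (fun L : F →L[ℝ] F ↦ L (Z' y)) h1
    refine h2.symm.trans ?_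
    exact Bundle.Trivialization.continuousLinearMapAt_apply_of_mem ℝ _ hy _
  have hcomp {Z : ∀ q : M, TangentSpace 𝓘(ℝ, E) q} {Z' : ∀ y : N, TangentSpace 𝓘(ℝ, F) y}
      (hZ' : MDiffAt (T% Z') (i p)) (hZZ' : ∀ᶠ q in 𝓝 p, Z' (i q) = pushField F i Z q)
      (v : TangentSpace 𝓘(ℝ, E) p) :
      mvfderiv 𝓘(ℝ, F) (fun y ↦ mvfderiv 𝓘(ℝ, F) f y (Z' y)) (i p)
          (mfderiv 𝓘(ℝ, E) 𝓘(ℝ, F) i p v) =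
        mvfderiv 𝓘(ℝ, E) (fun q ↦ mvfderiv 𝓘(ℝ, E) (f ∘ i) q (Z q)) p v := by
    have h1 : (fun y ↦ mvfderiv 𝓘(ℝ, F) f y (Z' y)) ∘ i =ᶠ[𝓝 p]
        fun q ↦ mvfderiv 𝓘(ℝ, E) (f ∘ i) q (Z q) := by
      filter_upwards [hZZ', (hi.continuous.tendsto p).eventually hsrc] with q hq hq'
      rw [Function.comp_apply, hq, hchain (mdifferentiableAt_extChartAt hq')]
      rfl
    rw [← hchain (hd hZ')]
    exact congrArg (fun L : E →L[ℝ] F ↦ L v) (h1.mfderiv_eq (I := 𝓘(ℝ, E)) (I' := 𝓘(ℝ, F)))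
  -- The commutator formula for `f` on `N` and for `f ∘ i` on `M` have the same right-hand side, by
  -- the chain rule and relatedness.
  have h1 := mvfderiv_apply_mlieBracket hf hX' hY'
  have h2 := mvfderiv_apply_mlieBracket hfi hX hY
  rw [hXX'.self_of_nhds, hYY'.self_of_nhds, pushField, pushField, hcomp hX' hXX', hcomp hY' hYY',
    ← h2, hchain (mdifferentiableAt_extChartAt (mem_chart_source F (i p)))] at h1
  have h3 : mfderiv 𝓘(ℝ, F) 𝓘(ℝ, F) f (i p) = ContinuousLinearMap.id ℝ F :=
    mfderiv_extChartAt_self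
  have h4 (w : TangentSpace 𝓘(ℝ, F) (i p)) : mvfderiv 𝓘(ℝ, F) f (i p) w = w :=
    congrArg (fun L : F →L[ℝ] F ↦ L w) h3
  rw [h4, h4] at h1
  exact h1

/-- An immersion has differentiable local left inverses. -/
theorem exists_local_retraction_of_isImmersion {i : M → N}
    (hi : Manifold.IsImmersion 𝓘(ℝ, E) 𝓘(ℝ, F) ∞ i) (p : M) :
    ∃ G : N → M, MDifferentiableAt 𝓘(ℝ, F) 𝓘(ℝ, E) G (i p) ∧ ∀ᶠ q in 𝓝 p, G (i q) = q := by
  have h := hi.isImmersionAt p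
  set φ := h.domChart.extend 𝓘(ℝ, E) with hφ
  set ψ := h.codChart.extend 𝓘(ℝ, F) with hψ
  have hsrc : φ.source = h.domChart.source := by simp [hφ]
  have hpsrc : p ∈ φ.source := hsrc ▸ h.mem_domChart_source
  have hloc : ∀ q ∈ φ.source, ψ (i q) = h.equiv (φ q, 0) := by
    intro q hq
    have h1 := h.writtenInCharts (φ.map_source hq)
    have h2 : (ψ ∘ i ∘ φ.symm) (φ q) = ψ (i q) := by
      simp only [Function.comp_apply, φ.left_inv hq]
    rw [← h2]
    exact h1
  have hψd : MDifferentiableAt 𝓘(ℝ, F) 𝓘(ℝ, F) ψ (i p) :=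
    (OpenPartialHomeomorph.contMDiffAt_extend h.codChart_mem_maximalAtlas
      h.mem_codChart_source).mdifferentiableAt (by simp)
  have hφs : MDifferentiableAt 𝓘(ℝ, E) 𝓘(ℝ, E) φ.symm (φ p) := by
    have h1 := contMDiffOn_extend_symm h.domChart_mem_maximalAtlas
    have h2 : 𝓘(ℝ, E) '' h.domChart.target = h.domChart.target := by simp
    rw [h2] at h1
    exact (h1.contMDiffAt (h.domChart.open_target.mem_nhds
      (h.domChart.map_source h.mem_domChart_source))).mdifferentiableAt (by simp)
  -- In adapted charts the immersion is `u ↦ (u, 0)`; projecting to the first factor inverts it.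
  let pr : F →L[ℝ] E :=
    (ContinuousLinearMap.fst ℝ E h.complement).comp h.equiv.symm.toContinuousLinearMap
  have hpr : ∀ q ∈ φ.source, pr (ψ (i q)) = φ q := by
    intro q hq
    simp [pr, hloc q hq]
  refine ⟨φ.symm ∘ pr ∘ ψ, ?_, ?_⟩
  · refine MDifferentiableAt.comp (I' := 𝓘(ℝ, E)) (i p) ?_
      (pr.differentiableAt.mdifferentiableAt.comp (i p) hψd)
    rw [Function.comp_apply, hpr p hpsrc]
    exact hφs
  · have hnear : ∀ᶠ q in 𝓝 p, q ∈ φ.source := by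
      rw [hsrc]
      exact h.domChart.open_source.mem_nhds h.mem_domChart_source
    filter_upwards [hnear] with q hq
    simp [hpr q hq, φ.left_inv hq]

/-- A vector field along an immersion extends locally to the ambient manifold. -/
theorem exists_extension_of_isImmersion {i : M → N}
    (hi : Manifold.IsImmersion 𝓘(ℝ, E) 𝓘(ℝ, F) ∞ i) (p : M)
    {V : ∀ q : M, TangentSpace 𝓘(ℝ, F) (i q)}
    (hV : MDifferentiableAt 𝓘(ℝ, E) 𝓘(ℝ, F).tangent
      (fun q ↦ (⟨i q, V q⟩ : TangentBundle 𝓘(ℝ, F) N)) p) :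
    ∃ V' : ∀ y : N, TangentSpace 𝓘(ℝ, F) y, MDiffAt (T% V') (i p) ∧
      ∀ᶠ q in 𝓝 p, V' (i q) = V q := by
  have : IsManifold 𝓘(ℝ, F) 1 N := IsManifold.of_le (n := ∞) (by simp)
  obtain ⟨G, hG, hGi⟩ := exists_local_retraction_of_isImmersion hi p
  set e := trivializationAt F (TangentSpace 𝓘(ℝ, F)) (i p) with he
  have hGp : G (i p) = p := hGi.self_of_nhds
  have hne : ∀ᶠ y in 𝓝 (i p), y ∈ e.baseSet :=
    e.open_baseSet.mem_nhds (FiberBundle.mem_baseSet_trivializationAt' (i p))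
  have hc : ContinuousAt i p := hi.contMDiff.continuous.continuousAt
  -- The vector `V (G y)` sits over `i (G y)`, which need not be `y`. Its components in the
  -- trivialization at `i p` are therefore reinserted in the fibre over `y`.
  refine ⟨fun y ↦ e.symm y (e ⟨i (G y), V (G y)⟩).2, ?_, ?_⟩
  · rw [mdifferentiableAt_section]
    have h1 := ((mdifferentiableAt_totalSpace _ _).1 hV).2
    have h2 : MDifferentiableAt 𝓘(ℝ, F) 𝓘(ℝ, F)
        ((fun q ↦ (e ⟨i q, V q⟩).2) ∘ G) (i p) := by
      refine MDifferentiableAt.comp (I' := 𝓘(ℝ, E)) (i p) ?_ hG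
      rw [hGp]
      exact h1
    refine h2.congr_of_eventuallyEq ?_
    filter_upwards [hne] with y hy
    rw [← he, e.apply_mk_symm hy]
    rfl
  · filter_upwards [hGi, hc.eventually hne] with q hq hq'
    rw [hq]
    exact e.symm_apply_apply_mk hq' (V q)

/-! ### The ambient connection along the immersion -/

variable (cov : CovariantDerivative 𝓘(ℝ, F) F (fun x : N ↦ TangentSpace 𝓘(ℝ, F) x))

/-- The covariant derivative along a map depends only on the germ of the field. -/
theorem covAlong_congr {i : M → N} {V W : ∀ q : M, TangentSpace 𝓘(ℝ, F) (i q)} {p : M}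
    (h : ∀ᶠ q in 𝓝 p, V q = W q) : covAlong (E := E) cov i V p = covAlong cov i W p := by
  ext v
  have h1 : (fun q ↦ (trivializationAt F (TangentSpace 𝓘(ℝ, F)) (i p) ⟨i q, V q⟩).2) =ᶠ[𝓝 p]
      fun q ↦ (trivializationAt F (TangentSpace 𝓘(ℝ, F)) (i p) ⟨i q, W q⟩).2 := by
    filter_upwards [h] with q hq
    rw [hq]
  have h2 := congrArg (fun L : E →L[ℝ] F ↦ L v)
    (h1.mfderiv_eq (I := 𝓘(ℝ, E)) (I' := 𝓘(ℝ, F)))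
  rw [covAlong, covAlong, h.self_of_nhds]
  congr 2

/-- For the restriction to `M` of an ambient field, the covariant derivative along an immersion is
the ambient one. -/
theorem covAlong_eq_of_eventuallyEq [FiniteDimensional ℝ F] {i : M → N}
    {V : ∀ q : M, TangentSpace 𝓘(ℝ, F) (i q)} {V' : ∀ y : N, TangentSpace 𝓘(ℝ, F) y} {p : M}
    (hi : MDifferentiableAt 𝓘(ℝ, E) 𝓘(ℝ, F) i p) (hV' : MDiffAt (T% V') (i p))
    (h : ∀ᶠ q in 𝓝 p, V' (i q) = V q) (v : TangentSpace 𝓘(ℝ, E) p) :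
    covAlong cov i V p v = cov V' (i p) (mfderiv 𝓘(ℝ, E) 𝓘(ℝ, F) i p v) := by
  rw [← covAlong_comp cov i V' p v hi hV', covAlong_congr cov h]

/-- The image of a smooth vector field under a smooth map is smooth along the map. -/
theorem mdifferentiableAt_pushField {i : M → N} (hi : ContMDiff 𝓘(ℝ, E) 𝓘(ℝ, F) ∞ i)
    {X : ∀ q : M, TangentSpace 𝓘(ℝ, E) q}
    (hX : ContMDiff 𝓘(ℝ, E) 𝓘(ℝ, E).tangent ∞ (T% X)) (p : M) :
    MDifferentiableAt 𝓘(ℝ, E) 𝓘(ℝ, F).tangent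
      (fun q ↦ (⟨i q, pushField F i X q⟩ : TangentBundle 𝓘(ℝ, F) N)) p := by
  have h1 := hi.contMDiff_tangentMap (m := 1) (by rw [one_add_one_eq_two]; exact ENat.LEInfty.out)
  exact (h1.comp (hX.of_le (by simp))).mdifferentiable (by simp) p

/-- The Levi-Civita connection along an immersion is torsion-free. -/
theorem IsLeviCivita.covAlong_sub_covAlong [FiniteDimensional ℝ E] [FiniteDimensional ℝ F]
    {g : SemiRiemannianMetric F N} {cov}
    (hcov : IsLeviCivita g cov) {i : M → N} (hi : Manifold.IsImmersion 𝓘(ℝ, E) 𝓘(ℝ, F) ∞ i)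
    {X Y : ∀ q : M, TangentSpace 𝓘(ℝ, E) q}
    (hX : ContMDiff 𝓘(ℝ, E) 𝓘(ℝ, E).tangent ∞ (T% X))
    (hY : ContMDiff 𝓘(ℝ, E) 𝓘(ℝ, E).tangent ∞ (T% Y)) (p : M) :
    covAlong cov i (pushField F i Y) p (X p) - covAlong cov i (pushField F i X) p (Y p) =
      pushField F i (VectorField.mlieBracket 𝓘(ℝ, E) X Y) p := by
  have : CompleteSpace E := FiniteDimensional.complete ℝ E
  have : CompleteSpace F := FiniteDimensional.complete ℝ F
  have hid : MDifferentiableAt 𝓘(ℝ, E) 𝓘(ℝ, F) i p := hi.contMDiff.mdifferentiable (by simp) p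
  obtain ⟨X', hX', hXX'⟩ :=
    exists_extension_of_isImmersion hi p (mdifferentiableAt_pushField hi.contMDiff hX p)
  obtain ⟨Y', hY', hYY'⟩ :=
    exists_extension_of_isImmersion hi p (mdifferentiableAt_pushField hi.contMDiff hY p)
  rw [← mlieBracket_apply_of_related hi.contMDiff (hX.mdifferentiable (by simp) p)
      (hY.mdifferentiable (by simp) p) hX' hY' hXX' hYY', ← hcov.torsion_free X' Y' _ hX' hY',
    covAlong_eq_of_eventuallyEq cov hid hX' hXX', covAlong_eq_of_eventuallyEq cov hid hY' hYY',
    hXX'.self_of_nhds, hYY'.self_of_nhds]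
  rfl

/-- The nearly `μ`-Sasakian condition along an immersion. -/
theorem IsNearlyMuSasakian.covAlong_add_covAlong [FiniteDimensional ℝ F]
    {g : SemiRiemannianMetric F N} {C : AlmostContactMetricStructure g} {cov} {μ : N → ℝ}
    (hN : IsNearlyMuSasakian C cov μ) {i : M → N}
    (hi : Manifold.IsImmersion 𝓘(ℝ, E) 𝓘(ℝ, F) ∞ i) {X Y : ∀ q : M, TangentSpace 𝓘(ℝ, E) q}
    (hX : ContMDiff 𝓘(ℝ, E) 𝓘(ℝ, E).tangent ∞ (T% X))
    (hY : ContMDiff 𝓘(ℝ, E) 𝓘(ℝ, E).tangent ∞ (T% Y)) (p : M) :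
    covAlong cov i (fun q ↦ C.φ (i q) (pushField F i Y q)) p (X p) +
        covAlong cov i (fun q ↦ C.φ (i q) (pushField F i X q)) p (Y p) =
      C.φ (i p) (covAlong cov i (pushField F i Y) p (X p)) +
        C.φ (i p) (covAlong cov i (pushField F i X) p (Y p)) +
        μ (i p) • ((2 * g.val (i p) (pushField F i X p) (pushField F i Y p)) • C.ξ (i p) -
          C.η (i p) (pushField F i Y p) • pushField F i X p -
          C.η (i p) (pushField F i X p) • pushField F i Y p) := by
  have hid : MDifferentiableAt 𝓘(ℝ, E) 𝓘(ℝ, F) i p := hi.contMDiff.mdifferentiable (by simp) p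
  obtain ⟨X', hX', hXX'⟩ :=
    exists_extension_of_isImmersion hi p (mdifferentiableAt_pushField hi.contMDiff hX p)
  obtain ⟨Y', hY', hYY'⟩ :=
    exists_extension_of_isImmersion hi p (mdifferentiableAt_pushField hi.contMDiff hY p)
  -- If `Z'` extends a field along `i`, then `φ Z'` extends its image under `φ`; this gives
  -- extensions for all four derivatives in the identity.
  have hφ {Z' : ∀ y : N, TangentSpace 𝓘(ℝ, F) y} (hZ' : MDiffAt (T% Z') (i p)) :
      MDiffAt (T% fun y ↦ C.φ y (Z' y)) (i p) :=
    (C.φ_contMDiff.mdifferentiable (by simp) (i p)).clm_bundle_apply hZ'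
  have h := hN.nearly X' Y' (i p) hX' hY'
  rw [covAlong_eq_of_eventuallyEq cov hid hX' hXX', covAlong_eq_of_eventuallyEq cov hid hY' hYY',
    covAlong_eq_of_eventuallyEq cov hid (hφ hX') (hXX'.mono fun q hq ↦ congrArg (C.φ (i q)) hq),
    covAlong_eq_of_eventuallyEq cov hid (hφ hY') (hYY'.mono fun q hq ↦ congrArg (C.φ (i q)) hq)]
  simp only [covDerivEndo, hXX'.self_of_nhds, hYY'.self_of_nhds] at h
  rw [← h]
  simp only [pushField]
  abel

end Related

/-! ### Integrability, projections and the action of `φ` on `D` and `D̄` -/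

section Main

variable {E : Type*} [NormedAddCommGroup E] [NormedSpace ℝ E]
  {F : Type*} [NormedAddCommGroup F] [NormedSpace ℝ F]
  {M : Type*} [TopologicalSpace M] [ChartedSpace E M] [IsManifold 𝓘(ℝ, E) ∞ M]
  {N : Type*} [TopologicalSpace N] [ChartedSpace F N] [IsManifold 𝓘(ℝ, F) ∞ N]
  {g : SemiRiemannianMetric F N} {i : M → N}

theorem pushField_mem_tangentImage (X : ∀ q : M, TangentSpace 𝓘(ℝ, E) q) (p : M) :
    pushField F i X p ∈ tangentImage E F i p := ⟨X p, rfl⟩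

/-- The Lie bracket of smooth fields is smooth, so integrability is a pointwise condition. -/
theorem isIntegrableDistribution_iff [CompleteSpace E]
    {W : ∀ p : M, Submodule ℝ (TangentSpace 𝓘(ℝ, F) (i p))} :
    IsIntegrableDistribution E W ↔
      ∀ X Y : ∀ p : M, TangentSpace 𝓘(ℝ, E) p, IsSectionOf W X → IsSectionOf W Y →
        ∀ p, pushField F i (VectorField.mlieBracket 𝓘(ℝ, E) X Y) p ∈ W p := by
  refine ⟨fun h X Y hX hY p ↦ (h X Y hX hY).mem p, fun h X Y hX hY ↦ ⟨?_, h X Y hX hY⟩⟩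
  -- The bracket costs one derivative, but `∞ + 1 = ∞`.
  have : IsManifold 𝓘(ℝ, E) (((⊤ : ℕ∞) : ℕ∞ω) + 1) M := ‹IsManifold 𝓘(ℝ, E) ∞ M›
  have : IsManifold 𝓘(ℝ, E) (minSmoothness ℝ 2) M :=
    IsManifold.of_le (n := ∞) (by simpa using ENat.LEInfty.out)
  exact ContDiff.mlieBracket_vectorField (m := ⊤) (n := ⊤) hX.contMDiff hY.contMDiff (by simp)

namespace LightlikeSubmanifold

variable [FiniteDimensional ℝ F] (L : LightlikeSubmanifold (E := E) g i) {p : M}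

theorem trans_eq_zero {w : TangentSpace 𝓘(ℝ, F) (i p)} (hw : w ∈ tangentImage E F i p) :
    L.trans p w = 0 :=
  (Submodule.projection_apply_eq_zero_iff (L.isCompl_tr p).symm).2 hw

theorem trans_eq_self {w : TangentSpace 𝓘(ℝ, F) (i p)} (hw : w ∈ L.tr p) : L.trans p w = w :=
  Submodule.projection_apply_of_mem_left (L.isCompl_tr p).symm hw

theorem mfderiv_tan_of_mem {w : TangentSpace 𝓘(ℝ, F) (i p)} (hw : w ∈ tangentImage E F i p) :
    mfderiv 𝓘(ℝ, E) 𝓘(ℝ, F) i p (L.tan p w) = w := by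
  have h := L.tan_add_trans p w
  rwa [L.trans_eq_zero hw, add_zero] at h

theorem tan_eq_zero_iff {w : TangentSpace 𝓘(ℝ, F) (i p)} : L.tan p w = 0 ↔ w ∈ L.tr p := by
  constructor
  · intro h
    have h1 := L.tan_add_trans p w
    rw [h, map_zero, zero_add] at h1
    rw [← h1]
    exact Submodule.projection_apply_mem (L.isCompl_tr p).symm w
  · intro hw
    apply mfderiv_injective_of_isImmersion L.immersion p
    have h := L.tan_add_trans p w
    rw [L.trans_eq_self hw, add_eq_right] at h
    rw [map_zero]
    exact h

end LightlikeSubmanifold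

namespace QGCRStructure

variable {L : LightlikeSubmanifold (E := E) g i} {C : AlmostContactMetricStructure g}
  (Q : QGCRStructure L C) {p : M}

theorem Dbar_le_screen : Q.Dbar p ≤ L.screen p :=
  (le_sup_right.trans le_sup_left).trans_eq (Q.screen_sup p)

theorem Dbar_le : Q.Dbar p ≤ tangentImage E F i p :=
  Q.Dbar_le_screen.trans (le_sup_right.trans_eq (L.screen_sup p))

theorem D_le : Q.D p ≤ tangentImage E F i p := by
  have hs : L.screen p ≤ tangentImage E F i p := le_sup_right.trans_eq (L.screen_sup p)
  exact sup_le (sup_le inf_le_left ((le_sup_right.trans_eq (Q.screen_sup p)).trans hs))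
    ((Q.φ_D₂ p).trans hs)

/-- Both sides are sums of `Rad TM`, `D₀`, `φ D₂` and `D̄`. Directness of the sum is not needed
later. -/
theorem D_sup_Dbar : Q.D p ⊔ Q.Dbar p = tangentImage E F i p := by
  rw [← L.screen_sup p, ← Q.screen_sup p, QGCRStructure.D]
  ac_rfl

/-- The characteristic field is orthogonal to a co-screen submanifold. -/
theorem _root_.LightlikeSubmanifold.IsCoScreen.η_eq_zero (hξ : L.IsCoScreen C)
    {v : TangentSpace 𝓘(ℝ, F) (i p)} (hv : v ∈ tangentImage E F i p) : C.η (i p) v = 0 := by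
  have h1 : C.ξ (i p) ∈ g.perp (i p) (tangentImage E F i p) :=
    L.screenTrans_sup p ▸ Submodule.mem_sup_right (hξ p)
  rw [C.η_eq, g.symm]
  exact LinearMap.BilinForm.mem_orthogonal_iff.1 h1 v hv

theorem _root_.LightlikeSubmanifold.IsCoScreen.φ_φ (hξ : L.IsCoScreen C)
    {v : TangentSpace 𝓘(ℝ, F) (i p)} (hv : v ∈ tangentImage E F i p) :
    C.φ (i p) (C.φ (i p) v) = -v := by
  rw [C.φ_φ, hξ.η_eq_zero hv, zero_smul, add_zero]

/-- `φ` is injective on the tangent spaces of a co-screen submanifold. -/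
theorem _root_.LightlikeSubmanifold.IsCoScreen.eq_zero_of_φ_eq_zero (hξ : L.IsCoScreen C)
    {v : TangentSpace 𝓘(ℝ, F) (i p)} (hv : v ∈ tangentImage E F i p) (h : C.φ (i p) v = 0) :
    v = 0 := by
  have h1 := hξ.φ_φ hv
  rwa [h, map_zero, eq_comm, neg_eq_zero] at h1

/-- Each of `D₁` and `D₀` is mapped into itself, while `D₂` and `φ D₂` are exchanged because `φ² =
-1` on tangent vectors. -/
theorem φ_mem_D (hξ : L.IsCoScreen C) {v : TangentSpace 𝓘(ℝ, F) (i p)} (hv : v ∈ Q.D p) :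
    C.φ (i p) v ∈ Q.D p := by
  have hD₁ {w : TangentSpace 𝓘(ℝ, F) (i p)} (hw : w ∈ radicalSpace E g i p) : w ∈ Q.D p :=
    Submodule.mem_sup_left (Submodule.mem_sup_left hw)
  obtain ⟨w, hw, _, ⟨b, hb, rfl⟩, rfl⟩ := Submodule.mem_sup.1 hv
  obtain ⟨r, hr, d, hd, rfl⟩ := Submodule.mem_sup.1 hw
  rw [← Q.rad_sup p] at hr
  obtain ⟨a, ha, c, hc, rfl⟩ := Submodule.mem_sup.1 hr
  have h1 {w : TangentSpace 𝓘(ℝ, F) (i p)} (hw : w ∈ Q.D₂ p) : w ∈ radicalSpace E g i p :=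
    Q.rad_sup p ▸ Submodule.mem_sup_right hw
  simp only [map_add]
  refine add_mem (add_mem (add_mem ?_ ?_) ?_) ?_
  · apply hD₁
    rw [← Q.rad_sup p]
    refine Submodule.mem_sup_left ?_
    rw [← Q.φ_D₁ p]
    exact Submodule.mem_map_of_mem ha
  · exact Submodule.mem_sup_right (Submodule.mem_map_of_mem hc)
  · exact Submodule.mem_sup_left (Submodule.mem_sup_right
      (Q.φ_D₀ p (Submodule.mem_map_of_mem hd)))
  · have h2 : C.φ (i p) (C.φ (i p) b) = -b := hξ.φ_φ (h1 hb).1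
    change C.φ (i p) (C.φ (i p) b) ∈ Q.D p
    rw [h2]
    exact neg_mem (hD₁ (h1 hb))

/-- `D̄` is spanned by images under `φ` of transversal vectors. Applying `φ` again returns them up
to sign and a multiple of `ξ`, which is transversal by the co-screen condition. -/
theorem φ_mem_tr (hξ : L.IsCoScreen C) {v : TangentSpace 𝓘(ℝ, F) (i p)} (hv : v ∈ Q.Dbar p) :
    C.φ (i p) v ∈ L.tr p := by
  have h (w : TangentSpace 𝓘(ℝ, F) (i p)) (hw : w ∈ L.tr p) :
      C.φ (i p) (C.φ (i p) w) ∈ L.tr p := by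
    rw [C.φ_φ]
    exact add_mem (neg_mem hw) (Submodule.smul_mem _ _ (Submodule.mem_sup_right (hξ p)))
  rw [← Q.Dbar_sup p] at hv
  obtain ⟨_, ⟨s, hs, rfl⟩, _, ⟨l, hl, rfl⟩, rfl⟩ := Submodule.mem_sup.1 hv
  rw [map_add]
  exact add_mem (h s (Submodule.mem_sup_right (Q.subS_le p hs)))
    (h l (Submodule.mem_sup_left (Q.subL_le p hl)))

variable [FiniteDimensional ℝ F]

/-- A tangent vector lies in `D` if and only if its image under `φ` is tangent. -/
theorem trans_φ_eq_zero_iff (hξ : L.IsCoScreen C) {v : TangentSpace 𝓘(ℝ, F) (i p)}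
    (hv : v ∈ tangentImage E F i p) : L.trans p (C.φ (i p) v) = 0 ↔ v ∈ Q.D p := by
  refine ⟨fun h ↦ ?_, fun h ↦ L.trans_eq_zero (Q.D_le (Q.φ_mem_D hξ h))⟩
  rw [← Q.D_sup_Dbar] at hv
  obtain ⟨d, hd, e, he, rfl⟩ := Submodule.mem_sup.1 hv
  rw [map_add, map_add, L.trans_eq_zero (Q.D_le (Q.φ_mem_D hξ hd)), zero_add,
    L.trans_eq_self (Q.φ_mem_tr hξ he)] at h
  -- The transversal part of `φ (d + e)` is exactly `φ e`, so injectivity of `φ` kills the `D̄`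
  -- component.
  rwa [hξ.eq_zero_of_φ_eq_zero (Q.Dbar_le he) h, add_zero]

/-- A tangent vector lies in `D̄` if and only if its image under `φ` is transversal. -/
theorem tan_φ_eq_zero_iff (hξ : L.IsCoScreen C) {v : TangentSpace 𝓘(ℝ, F) (i p)}
    (hv : v ∈ tangentImage E F i p) : L.tan p (C.φ (i p) v) = 0 ↔ v ∈ Q.Dbar p := by
  rw [L.tan_eq_zero_iff]
  refine ⟨fun h ↦ ?_, fun h ↦ Q.φ_mem_tr hξ h⟩
  rw [← Q.D_sup_Dbar] at hv
  obtain ⟨d, hd, e, he, rfl⟩ := Submodule.mem_sup.1 hv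
  rw [map_add] at h
  have h1 : C.φ (i p) d ∈ L.tr p := (Submodule.add_mem_iff_left _ (Q.φ_mem_tr hξ he)).1 h
  -- `φ d` is both tangent and transversal, hence zero.
  have h2 := Submodule.disjoint_def.1 (L.isCompl_tr p).disjoint _ (Q.D_le (Q.φ_mem_D hξ hd)) h1
  rwa [hξ.eq_zero_of_φ_eq_zero (Q.D_le hd) h2, zero_add]

/-- An equality of fields, not only of values at a point, because both sides are going to be
differentiated. -/
theorem pushField_phi₁ (hξ : L.IsCoScreen C) {X : ∀ q : M, TangentSpace 𝓘(ℝ, E) q}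
    (hX : IsSectionOf Q.D X) :
    pushField F i (L.phi₁ C X) = fun q ↦ C.φ (i q) (pushField F i X q) :=
  funext fun q ↦ L.mfderiv_tan_of_mem (Q.D_le (Q.φ_mem_D hξ (hX.mem q)))

theorem varphi₁_eq (hξ : L.IsCoScreen C) {X : ∀ q : M, TangentSpace 𝓘(ℝ, E) q}
    (hX : IsSectionOf Q.Dbar X) :
    L.varphi₁ C X = fun q ↦ C.φ (i q) (pushField F i X q) :=
  funext fun q ↦ L.trans_eq_self (Q.φ_mem_tr hξ (hX.mem q))

end QGCRStructure

/-! ### The nearly Sasakian identity in terms of `[X, Y]`, `∇` and `h` -/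

section Identities

variable [FiniteDimensional ℝ E] [FiniteDimensional ℝ F]
  {L : LightlikeSubmanifold (E := E) g i} {C : AlmostContactMetricStructure g}
  {cov : CovariantDerivative 𝓘(ℝ, F) F (fun x : N ↦ TangentSpace 𝓘(ℝ, F) x)} {μ : N → ℝ}
  {X Y : ∀ q : M, TangentSpace 𝓘(ℝ, E) q} {p : M}

/-- The second fundamental form is symmetric. -/
theorem LightlikeSubmanifold.secondFF_symm (L : LightlikeSubmanifold (E := E) g i)
    (hcov : IsLeviCivita g cov)
    (hX : ContMDiff 𝓘(ℝ, E) 𝓘(ℝ, E).tangent ∞ (T% X))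
    (hY : ContMDiff 𝓘(ℝ, E) 𝓘(ℝ, E).tangent ∞ (T% Y)) :
    L.secondFF cov X Y p = L.secondFF cov Y X p := by
  rw [← sub_eq_zero, LightlikeSubmanifold.secondFF, LightlikeSubmanifold.secondFF, ← map_sub,
    hcov.covAlong_sub_covAlong L.immersion hX hY]
  -- The antisymmetric part of the ambient derivative is the image of `[X, Y]`, which is tangent.
  exact L.trans_eq_zero ⟨_, rfl⟩

/-- `∇_Y X + h(X, Y)` is the ambient derivative of `X` in the direction `Y`. -/
theorem LightlikeSubmanifold.pushField_conn_add (L : LightlikeSubmanifold (E := E) g i)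
    (hcov : IsLeviCivita g cov)
    (hX : ContMDiff 𝓘(ℝ, E) 𝓘(ℝ, E).tangent ∞ (T% X))
    (hY : ContMDiff 𝓘(ℝ, E) 𝓘(ℝ, E).tangent ∞ (T% Y)) :
    pushField F i (L.conn cov Y X) p + L.secondFF cov X Y p =
      covAlong cov i (pushField F i X) p (Y p) := by
  rw [L.secondFF_symm hcov hX hY]
  exact L.tan_add_trans p _

/-- The nearly `μ`-Sasakian condition along a co-screen submanifold. -/
theorem IsNearlyMuSasakian.covAlong_add_covAlong_of_isCoScreen (hN : IsNearlyMuSasakian C cov μ)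
    (hξ : L.IsCoScreen C)
    (hX : ContMDiff 𝓘(ℝ, E) 𝓘(ℝ, E).tangent ∞ (T% X))
    (hY : ContMDiff 𝓘(ℝ, E) 𝓘(ℝ, E).tangent ∞ (T% Y)) :
    covAlong cov i (fun q ↦ C.φ (i q) (pushField F i Y q)) p (X p) +
        covAlong cov i (fun q ↦ C.φ (i q) (pushField F i X q)) p (Y p) =
      C.φ (i p) (pushField F i (VectorField.mlieBracket 𝓘(ℝ, E) X Y) p) +
        (2 : ℝ) • C.φ (i p) (pushField F i (L.conn cov Y X) p) +
        (2 : ℝ) • C.φ (i p) (L.secondFF cov X Y p) +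
        (2 * μ (i p) * g.val (i p) (pushField F i X p) (pushField F i Y p)) • C.ξ (i p) := by
  -- Both `η` terms vanish; torsion-freeness trades `∇̄_X Y` for `[X, Y] + ∇̄_Y X`, which produces
  -- the factors `2`.
  rw [hN.covAlong_add_covAlong L.immersion hX hY, hξ.η_eq_zero (pushField_mem_tangentImage X p),
    hξ.η_eq_zero (pushField_mem_tangentImage Y p), ← hN.leviCivita.covAlong_sub_covAlong L.immersion hX hY, map_sub,
    ← L.pushField_conn_add hN.leviCivita hX hY, map_add]
  module

end Identities

end Main

theorem mainTheorem3
    {E : Type*} [NormedAddCommGroup E] [NormedSpace ℝ E] [FiniteDimensional ℝ E]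
    {F : Type*} [NormedAddCommGroup F] [NormedSpace ℝ F] [FiniteDimensional ℝ F]
    {M : Type*} [TopologicalSpace M] [T2Space M] [SecondCountableTopology M]
    [ChartedSpace E M] [IsManifold 𝓘(ℝ, E) ∞ M]
    {N : Type*} [TopologicalSpace N] [T2Space N] [SecondCountableTopology N]
    [ChartedSpace F N] [IsManifold 𝓘(ℝ, F) ∞ N]
    (g : SemiRiemannianMetric F N) (C : AlmostContactMetricStructure g)
    (cov : CovariantDerivative 𝓘(ℝ, F) F (fun x : N ↦ TangentSpace 𝓘(ℝ, F) x))
    (μ : N → ℝ) (hN : IsNearlyMuSasakian C cov μ)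
    (i : M → N) (L : LightlikeSubmanifold (E := E) g i) (Q : QGCRStructure L C)
    (hξ : L.IsCoScreen C) :
    (IsIntegrableDistribution E Q.D ↔
      ∀ X Y : ∀ p : M, TangentSpace 𝓘(ℝ, E) p, IsSectionOf Q.D X → IsSectionOf Q.D Y → ∀ p : M,
        L.secondFF cov X (L.phi₁ C Y) p + L.secondFF cov Y (L.phi₁ C X) p =
          (2 : ℝ) • L.varphi₁ C (L.conn cov Y X) p + (2 : ℝ) • L.varphi₂ C (L.secondFF cov X Y) p +
            (2 * μ (i p) * g.val (i p) (pushField F i X p) (pushField F i Y p)) • C.ξ (i p)) ∧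
    (IsIntegrableDistribution E Q.Dbar ↔
      ∀ X Y : ∀ p : M, TangentSpace 𝓘(ℝ, E) p,
        IsSectionOf Q.Dbar X → IsSectionOf Q.Dbar Y → ∀ p : M,
        L.shape cov (L.varphi₁ C X) Y p + L.shape cov (L.varphi₁ C Y) X p =
          -(2 : ℝ) • L.phi₁ C (L.conn cov Y X) p - (2 : ℝ) • L.phi₂ C (L.secondFF cov X Y) p) := by
  have : CompleteSpace E := FiniteDimensional.complete ℝ E
  have hξtr (p : M) : C.ξ (i p) ∈ L.tr p := Submodule.mem_sup_right (hξ p)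
  constructor
  · rw [isIntegrableDistribution_iff]
    refine forall₄_congr fun X Y hX hY ↦ forall_congr' fun p ↦ ?_
    have h := congrArg (L.trans p)
      (hN.covAlong_add_covAlong_of_isCoScreen hξ hX.contMDiff hY.contMDiff (p := p))
    -- On `D` the field `φY` is tangent and equals `φ₁Y`, so the transversal parts of the
    -- derivatives on the left become values of `h`.
    rw [← Q.pushField_phi₁ hξ hX, ← Q.pushField_phi₁ hξ hY] at h
    simp only [map_add, map_smul, L.trans_eq_self (hξtr p)] at h
    rw [← Q.trans_φ_eq_zero_iff hξ (pushField_mem_tangentImage _ p)]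
    simp only [LightlikeSubmanifold.secondFF, LightlikeSubmanifold.varphi₁,
      LightlikeSubmanifold.varphi₂] at h ⊢
    -- The two sides differ exactly by the transversal part of `φ[X, Y]`.
    rw [h, add_assoc, add_assoc, add_assoc, add_eq_right]
  · rw [isIntegrableDistribution_iff]
    refine forall₄_congr fun X Y hX hY ↦ forall_congr' fun p ↦ ?_
    have h := congrArg (L.tan p)
      (hN.covAlong_add_covAlong_of_isCoScreen hξ hX.contMDiff hY.contMDiff (p := p))
    -- The `ξ` term is transversal, so no `μ` survives in the tangential equation.
    simp only [map_add, map_smul, L.tan_eq_zero_iff.2 (hξtr p), smul_zero, add_zero] at h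
    rw [← Q.tan_φ_eq_zero_iff hξ (pushField_mem_tangentImage _ p)]
    simp only [LightlikeSubmanifold.shape, LightlikeSubmanifold.phi₁, Q.varphi₁_eq hξ hX,
      Q.varphi₁_eq hξ hY, LightlikeSubmanifold.phi₂] at h ⊢
    -- The minus sign in the shape operator negates the identity; what is left over is the
    -- tangential part of `φ[X, Y]`.
    rw [← neg_add, add_comm (L.tan p _), h, neg_smul, ← neg_add', neg_inj, add_assoc, add_eq_right]
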